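/- **Setting.** Let $c_n$ ($n\ge 0$) be the fermionic annihilation operators of the sites of a half-infinite chain, acting on Fock space, and let $\gamma_n=c_n+c_n^\dagger$ and $\tilde\gamma_n=\mathrm i(c_n^\dagger-c_n)$. Let $(t_n)_{n\in\mathbb Z}$ be real with $\sum_n|t_n|<\infty$, and consider the half-infinite open chain $H=\frac{\mathrm i}{2}\sum_{m,n\ge 0}t_{m-n}\tilde\gamma_n\gamma_m$. An operator $X$ commutes with $H$ if $[X,H_L]\to 0$ in operator norm as $L\to\infty$, where $H_L$ is the part of the sum with $0\le m,n<L$. A real (respectively imaginary) *edge mode* is an operator $X=\sum_{n\ge0}g_n\gamma_n$ (respectively $X=\sum_{n\ge0}g_n\tilde\gamma_n$), the sum converging in norm, with $g_n\in\mathbb R$ and $\sum_n g_n^2<\infty$, that commutes with $H$. Let $f(z)=\sum_n t_nz^n$, suppose $f(z)\ne0$ for $|z|=1$, and let $\omega\in\mathbb Z$ be the winding number of $f$ on the unit circle about $0$. Let $V$ be a continuous logarithm of $z^{-\omega}f(z)$ on the unit circle. Write $(h)_k=\frac1{2\pi\mathrm i}\oint_{|z|=1} h(z)z^{-k-1}\,dz$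 for Fourier coefficients, and let $b_\pm(z)=\exp\big(\sum_{k\ge1}V_{\pm k}z^{\pm k}\big)$ with $V_k=(V)_k$ be the Wiener–Hopf factors, so that $f=z^\omega e^{V_0}b_+b_-$. A function $h$ on the unit circle *has singularities* at the distinct points $e^{\mathrm i\theta_1},\dots,e^{\mathrm i\theta_r}$, of real orders $\Omega_{\theta_1},\dots,\Omega_{\theta_r}$, if as $n\to+\infty$ there is an asymptotic expansion to all orders $$(h)_n\sim\sum_{s=1}^r e^{\mathrm in\theta_s}\sum_{j\ge0}a_{s,j}\,n^{-\Omega_{\theta_s}-p_{s,j}},\qquad a_{s,0}\neq0,\quad 0=p_{s,0}<p_{s,1}<\cdots\to\infty ,$$ where the $p_{s,j}$ are real numbers, not necessarily integers. **Theorem 2 (Edge mode from singularity-filling).** Let $\omega>0$, and suppose that $h(z)=b_-(1/z)^{-1}$ has singularities, $r\ge1$ in number, in this sense. Let $\varepsilon_1\le\dots\le\varepsilon_\omega$ be the $\omega$ lowest of the levels $\Omega_{\theta_s}+n$ over all pairs $(s,n)$ with $1\le s\le r$ and $n\in\mathbb Z_{\ge0}$, counted with multiplicity. For $0\le m\le\omega-1$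 put $\gamma_L^{(m)}=\sum_{n\ge0}(h)_{n-m}\gamma_n$; these sums converge in norm. Then there are real edge modes $\hat\gamma_L^{(p)}=\sum_{n\ge0}\hat g_n^{(p)}\gamma_n$, $1\le p\le\omega$, such that - they form a basis of the real vector space spanned by $\gamma_L^{(0)},\dots,\gamma_L^{(\omega-1)}$, and this space contains every real edge mode $\sum_n g_n\gamma_n$ with $\sum_n|g_n|<\infty$; - they mutually anticommute: $\hat\gamma_L^{(p)}\hat\gamma_L^{(q)}+\hat\gamma_L^{(q)}\hat\gamma_L^{(p)}=0$ for $p\ne q$; - $\hat g_n^{(p)}=O(n^{-\varepsilon_p})$ as $n\to\infty$, for each $p$. If $\omega<0$, the same holds with $|\omega|$ in place of $\omega$ as the number of modes and levels, with $h(z)=b_+(z)^{-1}$, and with $\gamma_n$ replaced by $\tilde\gamma_n$ (so the modes are imaginary edge modes). -/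

import Mathlib

open Complex Set Filter Topology Asymptotics

/-- Fermionic Fock space of the half-infinite chain with sites `0, 1, 2, …`: square-summable
amplitudes `ψ S` indexed by the finite sets `S` of occupied sites. -/
abbrev FockSpace : Type := lp (fun _ : Finset ℕ => ℂ) 2

/-- Bounded operators on Fock space, with the operator norm. -/
abbrev FockOp : Type := FockSpace →L[ℂ] FockSpace

/-- Amplitudes of `c_n ψ` (with the Jordan–Wigner sign), i.e.
`c_n |T⟩ = (-1)^{#{k ∈ T, k < n}} |T ∖ {n}⟩` if `n ∈ T`, and `c_n |T⟩ = 0` otherwise. -/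
noncomputable def annihilateFun (n : ℕ) (ψ : Finset ℕ → ℂ) (S : Finset ℕ) : ℂ :=
  if n ∈ S then 0 else (-1) ^ (S.filter (· < n)).card * ψ (insert n S)

theorem norm_annihilateFun_le (n : ℕ) (ψ : Finset ℕ → ℂ) (S : Finset ℕ) :
    ‖annihilateFun n ψ S‖ ≤ ‖ψ (symmDiff S {n})‖ := by
  unfold annihilateFun
  split_ifs with h
  · simp
  · have hS : symmDiff S {n} = insert n S := by
      ext k
      simp only [Finset.mem_symmDiff, Finset.mem_singleton, Finset.mem_insert]
      constructor
      · tauto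
      · rintro (rfl | hk)
        · exact Or.inr ⟨rfl, h⟩
        · exact Or.inl ⟨hk, fun e => h (e ▸ hk)⟩
    simp [hS]

theorem summable_norm_sq_flip (n : ℕ) (ψ : FockSpace) :
    Summable (fun S : Finset ℕ => ‖ψ (symmDiff S {n})‖ ^ (2 : ENNReal).toReal) := by
  have h := (lp.memℓp ψ).summable (by norm_num)
  exact ((symmDiff_left_involutive ({n} : Finset ℕ)).toPerm _).summable_iff.2 h

theorem memlp_annihilateFun (n : ℕ) (ψ : FockSpace) :
    Memℓp (annihilateFun n ψ) 2 := by
  refine memℓp_gen ?_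
  refine Summable.of_nonneg_of_le (fun S => by positivity) (fun S => ?_)
    (summable_norm_sq_flip n ψ)
  exact Real.rpow_le_rpow (norm_nonneg _) (norm_annihilateFun_le n ψ S) (by norm_num)

theorem norm_annihilateFun_lp_le (n : ℕ) (ψ : FockSpace) :
    ‖(⟨annihilateFun n ψ, memlp_annihilateFun n ψ⟩ : FockSpace)‖ ≤ ‖ψ‖ := by
  have h2 : 0 < (2 : ENNReal).toReal := by norm_num
  refine lp.norm_le_of_tsum_le h2 (norm_nonneg _) ?_
  have e := ((symmDiff_left_involutive ({n} : Finset ℕ)).toPerm _).tsum_eq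
    (fun S => ‖ψ S‖ ^ (2 : ENNReal).toReal)
  rw [lp.norm_rpow_eq_tsum h2 ψ, ← e]
  refine Summable.tsum_le_tsum (fun S => ?_)
    ((memlp_annihilateFun n ψ).summable h2) (summable_norm_sq_flip n ψ)
  exact Real.rpow_le_rpow (norm_nonneg _) (norm_annihilateFun_le n ψ S) (by norm_num)

/-- The annihilation operator `c_n` of the spinless fermion on site `n`. -/
noncomputable def annihilate (n : ℕ) : FockOp :=
  LinearMap.mkContinuous
    { toFun := fun ψ => (⟨annihilateFun n ψ, memlp_annihilateFun n ψ⟩ : FockSpace)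
      map_add' := fun ψ φ => by
        ext S
        simp only [annihilateFun, lp.coeFn_add, Pi.add_apply]
        split_ifs
        · simp
        · ring
      map_smul' := fun a ψ => by
        ext S
        simp only [annihilateFun, lp.coeFn_smul, Pi.smul_apply, smul_eq_mul, RingHom.id_apply]
        split_ifs
        · simp
        · ring }
    1 (fun ψ => by
      rw [one_mul]
      exact norm_annihilateFun_lp_le n ψ)

/-- The creation operator `c_n†`. -/
noncomputable def create (n : ℕ) : FockOp := ContinuousLinearMap.adjoint (annihilate n)

/-- The real Majorana operator `γ_n = c_n + c_n†`. -/
noncomputable def majoranaRe (n : ℕ) : FockOp := annihilate n + create n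

/-- The imaginary Majorana operator `γ̃_n = i (c_n† - c_n)`. -/
noncomputable def majoranaIm (n : ℕ) : FockOp := I • (create n - annihilate n)

/-- The open BDI chain on the sites `0, …, L - 1`:
`H_L = (i/2) ∑_{m,n} t_{m-n} γ̃_n γ_m`. -/
noncomputable def openChain (t : ℤ → ℝ) (L : ℕ) : FockOp :=
  (I / 2) • ∑ m ∈ Finset.range L, ∑ n ∈ Finset.range L,
    (t ((m : ℤ) - (n : ℤ)) : ℂ) • (majoranaIm n * majoranaRe m)

/-- `X` commutes with the half-infinite open chain. The Hamiltonian of that chain is an infinite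
sum, so `[X, H]` is the limit, in operator norm, of the commutators with the open chains on
`0, …, L - 1` as `L → ∞`. -/
def CommutesWithChain (t : ℤ → ℝ) (X : FockOp) : Prop :=
  Tendsto (fun L : ℕ => X * openChain t L - openChain t L * X) atTop (𝓝 0)

/-- `X = ∑_{n ≥ 0} g_n M_n` is a normalisable zero-energy edge mode with real wavefunction `g`;
here `M` is one of the two families `majoranaRe`, `majoranaIm`. -/
structure IsEdgeMode (t : ℤ → ℝ) (M : ℕ → FockOp) (g : ℕ → ℝ) (X : FockOp) : Prop where
  normalisable : Summable (fun n => g n ^ 2)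
  hasSum : HasSum (fun n => (g n : ℂ) • M n) X
  commutes : CommutesWithChain t X

/-- `f(z) = ∑_{n ∈ ℤ} t_n z^n`, for `z` on the unit circle. -/
noncomputable def symbol (t : ℤ → ℝ) (z : ℂ) : ℂ := ∑' n : ℤ, (t n : ℂ) * z ^ n

/-- A continuous branch of the argument of `f` increases by `2πω` once around the unit circle. -/
def HasWindingNumber (f : ℂ → ℂ) (ω : ℤ) : Prop :=
  ∃ φ : ℝ → ℝ, ContinuousOn φ (Icc 0 (2 * Real.pi)) ∧
    (∀ x ∈ Icc 0 (2 * Real.pi), f (exp (x * I)) = ‖f (exp (x * I))‖ * exp (φ x * I)) ∧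
    φ (2 * Real.pi) - φ 0 = 2 * Real.pi * ω

/-- `V` is a continuous logarithm of `z^{-ω} f(z)` on the unit circle. -/
def IsContinuousLog (f : ℂ → ℂ) (ω : ℤ) (V : ℂ → ℂ) : Prop :=
  ContinuousOn V (Metric.sphere 0 1) ∧
    ∀ z ∈ Metric.sphere (0 : ℂ) 1, exp (V z) = z ^ (-ω) * f z

/-- The Fourier coefficient `(h(z))_k = (2πi)⁻¹ ∮ h(z) z^{-(k+1)} dz` over the unit circle. -/
noncomputable def circleCoeff (h : ℂ → ℂ) (k : ℤ) : ℂ :=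
  (2 * Real.pi * I)⁻¹ * ∮ z in C(0, 1), h z * z ^ (-(k + 1))

/-- The Wiener–Hopf factor `b₊(z) = exp (∑_{k ≥ 1} V_k z^k)`. -/
noncomputable def wienerHopfPlus (V : ℂ → ℂ) (z : ℂ) : ℂ :=
  exp (∑' k : ℕ, circleCoeff V ((k : ℤ) + 1) * z ^ ((k : ℤ) + 1))

/-- The Wiener–Hopf factor `b₋(z) = exp (∑_{k ≥ 1} V_{-k} z^{-k})`. -/
noncomputable def wienerHopfMinus (V : ℂ → ℂ) (z : ℂ) : ℂ :=
  exp (∑' k : ℕ, circleCoeff V (-((k : ℤ) + 1)) * z ^ (-((k : ℤ) + 1)))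

/-- `h` has singularities at the distinct points `e^{iθ_s}` of the unit circle, of orders `Ω_s`:
as `n → ∞`, its Fourier coefficients have the asymptotic expansion
`∑_s e^{inθ_s} n^{-Ω_s} (a_{s,0} + a_{s,1} n^{-p_{s,1}} + a_{s,2} n^{-p_{s,2}} + …)`
with `a_{s,0} ≠ 0` and `0 = p_{s,0} < p_{s,1} < p_{s,2} < … → ∞`. The `p_{s,j}` need not be
integers, and coefficients beyond the leading one may vanish. -/
def HasSingularities (h : ℂ → ℂ) {r : ℕ} (θ Ω : Fin r → ℝ) : Prop :=
  Function.Injective (fun s => exp (θ s * I)) ∧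
  ∃ (a : Fin r → ℕ → ℂ) (p : Fin r → ℕ → ℝ),
    (∀ s, a s 0 ≠ 0 ∧ p s 0 = 0 ∧ StrictMono (p s) ∧ Tendsto (p s) atTop atTop) ∧
    ∀ K : ℕ,
      (fun n : ℕ => circleCoeff h n - ∑ s, ∑ j ∈ Finset.range K,
          exp (n * θ s * I) * a s j * (((n : ℝ) ^ (-(Ω s + p s j)) : ℝ) : ℂ))
        =O[atTop] fun n : ℕ => ∑ s, (n : ℝ) ^ (-(Ω s + p s K))

/-- `ε` lists, in increasing order and with multiplicity, the `k` lowest among the levels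
`Ω_s + n` over all pairs `(s, n)` with `n ≥ 0` an integer. -/
def IsLowestLevels {r k : ℕ} (Ω : Fin r → ℝ) (ε : Fin k → ℝ) : Prop :=
  Monotone ε ∧ ∃ σ : Fin k → Fin r × ℕ, Function.Injective σ ∧
    (∀ i, ε i = Ω (σ i).1 + (σ i).2) ∧
    ∀ q : Fin r × ℕ, q ∉ range σ → ∀ i, ε i ≤ Ω q.1 + q.2

/-! Only the Clifford relations of the Majorana operators enter. For `X = ∑ g_k M_k`, the commutator
with `H_L` is linear in the Majoranas of the other family, with coefficients the truncated rows of a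
Toeplitz operator applied to `g`. A finite combination of Majoranas has operator norm equal to the
ℓ² norm of its coefficients, so an edge mode has `g` in the kernel of the half-infinite Toeplitz
operator, and an absolutely summable `g` in that kernel gives an edge mode.

The kernel comes from Wiener–Hopf factorisation in ℓ¹(ℤ). By the Wiener–Lévy theorem the logarithm
lies in this algebra, so the Toeplitz symbol is `F = z^{-w} e^A e^B`, with `A` of positive and `B`
of nonpositive frequencies. If `G` has nonnegative frequencies and `FG` only negative ones, then `P
= G e^A = z^w (FG) e^{-B}` has frequencies in `[0, w)`. So `G = P e^{-A}`: the summable kernel is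
spanned by `w` translates of the coefficients of `1 / b₊` (`exists_wienerHopf`).

Choosing `P` is where singularities are filled. Multiplication by `z - e^{-iθ}` turns `e^{inθ} φ(n)`
into a backward difference of `φ`, which gains a power of `n`. Raising every order `Ω_s` to at least
`ε_p` costs one zero per level strictly below `ε_p`, hence (counting `p` from 0) at most `p` zeros.
This yields a monic `P` of degree `p` and a unitriangular change of basis
(`exists_monic_combination_decaying`). Gram–Schmidt from the fastest-decaying vector keeps the decay
rates, and orthogonal wavefunctions give anticommuting modes (`exists_edgeModes`). -/

/-! ### Jordan–Wigner action of the Majorana operators and their Clifford relations. -/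

/-- The Jordan–Wigner sign `(-1)^{#{k ∈ S, k < n}}`. -/
noncomputable def jwSign (n : ℕ) (S : Finset ℕ) : ℂ := (-1) ^ (S.filter (· < n)).card

theorem jwSign_mul_self (n : ℕ) (S : Finset ℕ) : jwSign n S * jwSign n S = 1 := by
  unfold jwSign
  rw [← mul_pow]
  simp

theorem conj_jwSign (n : ℕ) (S : Finset ℕ) : (starRingEnd ℂ) (jwSign n S) = jwSign n S := by
  simp [jwSign]

theorem jwSign_insert {m n : ℕ} {S : Finset ℕ} (h : n ∉ S) :
    jwSign m (insert n S) = (if n < m then -1 else 1) * jwSign m S := by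
  unfold jwSign
  rw [Finset.filter_insert]
  split_ifs with hnm
  · rw [Finset.card_insert_of_notMem (by simp [h]), pow_succ]
    ring
  · simp

theorem symmDiff_singleton_of_notMem {n : ℕ} {S : Finset ℕ} (h : n ∉ S) :
    symmDiff S {n} = insert n S := by
  ext k
  simp only [Finset.mem_symmDiff, Finset.mem_singleton, Finset.mem_insert]
  constructor
  · tauto
  · rintro (rfl | hk)
    · exact Or.inr ⟨rfl, h⟩
    · exact Or.inl ⟨hk, fun e => h (e ▸ hk)⟩

theorem symmDiff_singleton_of_mem {n : ℕ} {S : Finset ℕ} (h : n ∈ S) :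
    symmDiff S {n} = S.erase n := by
  ext k
  simp only [Finset.mem_symmDiff, Finset.mem_singleton, Finset.mem_erase]
  constructor
  · rintro (⟨h1, h2⟩ | ⟨rfl, h2⟩)
    · exact ⟨h2, h1⟩
    · exact absurd h h2
  · rintro ⟨h1, h2⟩
    exact Or.inl ⟨h2, h1⟩

theorem jwSign_symmDiff (m n : ℕ) (S : Finset ℕ) :
    jwSign m (symmDiff S {n}) = (if n < m then -1 else 1) * jwSign m S := by
  by_cases h : n ∈ S
  · rw [symmDiff_singleton_of_mem h]
    conv_rhs => rw [← Finset.insert_erase h, jwSign_insert (Finset.notMem_erase n S)]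
    split_ifs <;> ring
  · rw [symmDiff_singleton_of_notMem h, jwSign_insert h]

theorem annihilate_apply (n : ℕ) (ψ : FockSpace) (S : Finset ℕ) :
    annihilate n ψ S = if n ∈ S then 0 else jwSign n S * ψ (symmDiff S {n}) := by
  change annihilateFun n ψ S = _
  unfold annihilateFun
  split_ifs with h
  · rfl
  · rw [symmDiff_singleton_of_notMem h]
    rfl

theorem fock_apply_eq_inner (ψ : FockSpace) (S : Finset ℕ) :
    ψ S = inner ℂ (lp.single 2 S (1 : ℂ) : FockSpace) ψ := by
  rw [lp.inner_single_left]
  simp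

theorem annihilate_single (n : ℕ) (S : Finset ℕ) :
    annihilate n (lp.single 2 S (1 : ℂ)) =
      if n ∈ S then jwSign n S • (lp.single 2 (symmDiff S {n}) (1 : ℂ) : FockSpace) else 0 := by
  ext T
  rw [annihilate_apply]
  have key : symmDiff T {n} = S ↔ T = symmDiff S {n} := by
    constructor <;> rintro rfl <;> simp
  by_cases hT : T = symmDiff S {n}
  · subst hT
    by_cases hS : n ∈ S
    · have h2 : n ∉ symmDiff S {n} := by simp [Finset.mem_symmDiff, hS]
      simp only [h2, hS, if_false, if_true, lp.coeFn_smul, Pi.smul_apply, jwSign_symmDiff,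
        lt_irrefl, one_mul, symmDiff_symmDiff_cancel_right, lp.single_apply_self, smul_eq_mul]
    · have h2 : n ∈ symmDiff S {n} := by simp [Finset.mem_symmDiff, hS]
      simp [h2, hS]
  · have h1 : (lp.single 2 S (1 : ℂ) : FockSpace) (symmDiff T {n}) = 0 :=
      lp.single_apply_ne _ _ _ (fun h => hT (key.1 h))
    rw [h1]
    split_ifs with _ hS hS
    · simp only [lp.coeFn_smul, Pi.smul_apply, lp.single_apply_ne _ _ _ hT, smul_zero]
    · simp
    · simp only [lp.coeFn_smul, Pi.smul_apply, lp.single_apply_ne _ _ _ hT, smul_zero, mul_zero]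
    · simp

theorem create_apply (n : ℕ) (ψ : FockSpace) (S : Finset ℕ) :
    create n ψ S = if n ∈ S then jwSign n S * ψ (symmDiff S {n}) else 0 := by
  rw [fock_apply_eq_inner (create n ψ), create, ContinuousLinearMap.adjoint_inner_right,
    annihilate_single]
  split_ifs
  · rw [inner_smul_left, ← fock_apply_eq_inner, conj_jwSign]
  · simp

theorem majoranaRe_apply (n : ℕ) (ψ : FockSpace) (S : Finset ℕ) :
    majoranaRe n ψ S = jwSign n S * ψ (symmDiff S {n}) := by
  change annihilate n ψ S + create n ψ S = _
  rw [annihilate_apply, create_apply]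
  split_ifs <;> simp

theorem majoranaIm_apply (n : ℕ) (ψ : FockSpace) (S : Finset ℕ) :
    majoranaIm n ψ S =
      (if n ∈ S then I else -I) * (jwSign n S * ψ (symmDiff S {n})) := by
  change I * (create n ψ S - annihilate n ψ S) = _
  rw [annihilate_apply, create_apply]
  split_ifs <;> ring

theorem symmDiff_pair_comm (S : Finset ℕ) (m n : ℕ) :
    symmDiff (symmDiff S {m}) {n} = symmDiff (symmDiff S {n}) {m} :=
  symmDiff_right_comm S {m} {n}

theorem mem_symmDiff_singleton (S : Finset ℕ) (m n : ℕ) :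
    m ∈ symmDiff S {n} ↔ (if m = n then m ∉ S else m ∈ S) := by
  split_ifs with h
  · simp [Finset.mem_symmDiff, h]
  · simp [Finset.mem_symmDiff, h]

/-- The two flips commute as maps of occupied sets. For distinct sites, flipping the lower one
changes the sign string of the higher one, so the two orders differ by exactly one sign; for equal
sites both the flips and the signs square to the identity. -/
theorem majoranaRe_anticomm (m n : ℕ) :
    majoranaRe m * majoranaRe n + majoranaRe n * majoranaRe m =
      (if m = n then 2 else 0 : ℂ) • (1 : FockOp) := by
  ext ψ S
  change majoranaRe m (majoranaRe n ψ) S + majoranaRe n (majoranaRe m ψ) S =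
    (if m = n then 2 else 0 : ℂ) * ψ S
  simp only [majoranaRe_apply, jwSign_symmDiff]
  rcases lt_trichotomy m n with h | rfl | h
  · rw [symmDiff_pair_comm S n m]
    simp only [h, h.not_gt, h.ne, if_true, if_false]
    ring
  · simp only [lt_irrefl, if_false, if_true, symmDiff_symmDiff_cancel_right, one_mul,
      ← mul_assoc, jwSign_mul_self]
    ring
  · rw [symmDiff_pair_comm S n m]
    simp only [h, h.not_gt, h.ne', if_true, if_false]
    ring

theorem majoranaIm_anticomm (m n : ℕ) :
    majoranaIm m * majoranaIm n + majoranaIm n * majoranaIm m =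
      (if m = n then 2 else 0 : ℂ) • (1 : FockOp) := by
  ext ψ S
  change majoranaIm m (majoranaIm n ψ) S + majoranaIm n (majoranaIm m ψ) S =
    (if m = n then 2 else 0 : ℂ) * ψ S
  simp only [majoranaIm_apply, jwSign_symmDiff, mem_symmDiff_singleton]
  rcases lt_trichotomy m n with h | rfl | h
  · rw [symmDiff_pair_comm S n m]
    simp only [h, h.not_gt, h.ne, h.ne', if_true, if_false]
    ring
  · simp only [lt_irrefl, if_false, if_true, symmDiff_symmDiff_cancel_right, one_mul]
    have := jwSign_mul_self m S
    by_cases hm : m ∈ S <;> simp only [hm, not_true, not_false_iff, if_true, if_false] <;>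
      linear_combination (2 * ψ S) * this - 2 * jwSign m S ^ 2 * ψ S * I_sq
  · rw [symmDiff_pair_comm S n m]
    simp only [h, h.not_gt, h.ne, h.ne', if_true, if_false]
    ring

theorem majoranaRe_majoranaIm_anticomm (m n : ℕ) :
    majoranaRe m * majoranaIm n + majoranaIm n * majoranaRe m = 0 := by
  ext ψ S
  change majoranaRe m (majoranaIm n ψ) S + majoranaIm n (majoranaRe m ψ) S = 0
  simp only [majoranaRe_apply, majoranaIm_apply, jwSign_symmDiff, mem_symmDiff_singleton]
  rcases lt_trichotomy m n with h | rfl | h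
  · rw [symmDiff_pair_comm S n m]
    simp only [h, h.not_gt, h.ne', if_true, if_false]
    ring
  · simp only [lt_irrefl, if_false, if_true, symmDiff_symmDiff_cancel_right, one_mul]
    by_cases hm : m ∈ S <;> simp only [hm, not_true, not_false_iff, if_true, if_false] <;> ring
  · rw [symmDiff_pair_comm S n m]
    simp only [h, h.not_gt, h.ne, if_true, if_false]
    ring

theorem star_majoranaRe (n : ℕ) : star (majoranaRe n) = majoranaRe n := by
  simp only [majoranaRe, create, ← ContinuousLinearMap.star_eq_adjoint, star_add, star_star]
  rw [add_comm]

theorem star_majoranaIm (n : ℕ) : star (majoranaIm n) = majoranaIm n := by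
  simp only [majoranaIm, create, ← ContinuousLinearMap.star_eq_adjoint, star_smul, star_sub,
    star_star]
  rw [← neg_sub, smul_neg, ← neg_smul]
  simp

/-! ### The map from square-summable wavefunctions to operators. -/

/-- A self-adjoint family of operators with the Clifford relations `{M_m, M_n} = 2 δ_{mn}`. -/
structure IsMajoranaFamily (M : ℕ → FockOp) : Prop where
  star_eq : ∀ n, star (M n) = M n
  anticomm : ∀ m n, M m * M n + M n * M m = (if m = n then 2 else 0 : ℂ) • (1 : FockOp)

theorem isMajoranaFamily_re : IsMajoranaFamily majoranaRe :=
  ⟨star_majoranaRe, majoranaRe_anticomm⟩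

theorem isMajoranaFamily_im : IsMajoranaFamily majoranaIm :=
  ⟨star_majoranaIm, majoranaIm_anticomm⟩

instance : Nontrivial FockSpace :=
  ⟨lp.single 2 ∅ (1 : ℂ), 0, fun h => by
    have := congrArg (fun ψ : FockSpace => ψ ∅) h
    simp at this⟩

namespace IsMajoranaFamily

variable {M : ℕ → FockOp}

theorem anticomm_sum (hM : IsMajoranaFamily M) (s : Finset ℕ) (y z : ℕ → ℝ) :
    (∑ n ∈ s, (y n : ℂ) • M n) * (∑ n ∈ s, (z n : ℂ) • M n) +
      (∑ n ∈ s, (z n : ℂ) • M n) * (∑ n ∈ s, (y n : ℂ) • M n) =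
      ((2 * ∑ n ∈ s, y n * z n : ℝ) : ℂ) • (1 : FockOp) := by
  have h1 : (∑ n ∈ s, (z n : ℂ) • M n) * (∑ n ∈ s, (y n : ℂ) • M n) =
      ∑ m ∈ s, ∑ n ∈ s, ((y m : ℂ) * z n) • (M n * M m) := by
    rw [Finset.sum_mul_sum, Finset.sum_comm]
    refine Finset.sum_congr rfl fun m _ => Finset.sum_congr rfl fun n _ => ?_
    rw [smul_mul_smul_comm, mul_comm (z n : ℂ)]
  rw [h1, Finset.sum_mul_sum]
  simp only [smul_mul_smul_comm, ← Finset.sum_add_distrib, ← smul_add, hM.anticomm]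
  simp only [ite_smul, zero_smul, smul_ite, smul_zero, Finset.sum_ite_eq]
  rw [Finset.sum_congr rfl (g := fun m => ((y m : ℂ) * z m * 2) • (1 : FockOp))
    (fun m hm => by rw [if_pos hm, smul_smul]), ← Finset.sum_smul]
  congr 1
  push_cast
  rw [Finset.mul_sum]
  exact Finset.sum_congr rfl fun _ _ => by ring

/-- The sum is self-adjoint and its square is a scalar by the Clifford relations, so the C*-identity
computes its norm. -/
theorem norm_sum_sq (hM : IsMajoranaFamily M) (s : Finset ℕ) (y : ℕ → ℝ) :
    ‖∑ n ∈ s, (y n : ℂ) • M n‖ ^ 2 = ∑ n ∈ s, y n ^ 2 := by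
  set Y := ∑ n ∈ s, (y n : ℂ) • M n with hY
  have hs : star Y = Y := by
    simp only [hY, star_sum, star_smul, hM.star_eq]
    simp
  have h2 : Y * Y = ((∑ n ∈ s, y n ^ 2 : ℝ) : ℂ) • (1 : FockOp) := by
    have h := hM.anticomm_sum s y y
    rw [← hY, ← two_smul ℂ (Y * Y)] at h
    have h3 : (2 : ℂ)⁻¹ • (2 : ℂ) • (Y * Y) =
        (2 : ℂ)⁻¹ • ((2 * ∑ n ∈ s, y n * y n : ℝ) : ℂ) • (1 : FockOp) := by rw [h]
    rw [smul_smul, smul_smul, inv_mul_cancel₀ two_ne_zero, one_smul] at h3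
    rw [h3]
    congr 1
    push_cast
    simp only [sq]
    ring
  have h4 := CStarRing.norm_star_mul_self (x := Y)
  rw [hs, h2, norm_smul, norm_one, mul_one, Complex.norm_real,
    Real.norm_of_nonneg (Finset.sum_nonneg fun _ _ => sq_nonneg _)] at h4
  rw [h4, sq]

theorem norm_eq_one (hM : IsMajoranaFamily M) (n : ℕ) : ‖M n‖ = 1 := by
  have := hM.norm_sum_sq {n} 1
  simp only [Finset.sum_singleton, Pi.one_apply, ofReal_one, one_smul, one_pow] at this
  exact (pow_eq_one_iff_of_nonneg (norm_nonneg _) two_ne_zero).1 this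

/-- By `norm_sum_sq` the Cauchy criterion for the operators is that for `∑ g_n²`; absolute
convergence is not needed. -/
theorem summable_smul (hM : IsMajoranaFamily M) {g : ℕ → ℝ} (hg : Summable fun n => g n ^ 2) :
    Summable fun n => (g n : ℂ) • M n := by
  rw [summable_iff_vanishing_norm] at hg ⊢
  intro ε hε
  obtain ⟨s, hs⟩ := hg (ε ^ 2) (by positivity)
  refine ⟨s, fun u hu => ?_⟩
  have h1 := hs u hu
  rw [Real.norm_of_nonneg (Finset.sum_nonneg fun _ _ => sq_nonneg _), ← hM.norm_sum_sq] at h1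
  exact lt_of_pow_lt_pow_left₀ 2 hε.le h1

/-- The operator `∑ g_n M_n`, as a linear function of the wavefunction `g ∈ ℓ²`. -/
noncomputable def modeMap (hM : IsMajoranaFamily M) : lp (fun _ : ℕ => ℝ) 2 →ₗ[ℝ] FockOp where
  toFun g := ∑' n, (g n : ℂ) • M n
  map_add' g g' := by
    have h (g : lp (fun _ : ℕ => ℝ) 2) : Summable fun n => (g n : ℂ) • M n :=
      hM.summable_smul (by simpa using (lp.memℓp g).summable (by norm_num))
    rw [← (h g).tsum_add (h g')]
    simp [add_smul]
  map_smul' a g := by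
    have h : Summable fun n => (g n : ℂ) • M n :=
      hM.summable_smul (by simpa using (lp.memℓp g).summable (by norm_num))
    rw [RingHom.id_apply, ← h.tsum_const_smul a]
    refine tsum_congr fun n => ?_
    rw [lp.coeFn_smul, Pi.smul_apply, smul_eq_mul, ofReal_mul, mul_smul]
    exact Complex.coe_smul _ _

theorem summable_sq_lp (g : lp (fun _ : ℕ => ℝ) 2) : Summable fun n => g n ^ 2 := by
  simpa using (lp.memℓp g).summable (by norm_num)

theorem hasSum_modeMap (hM : IsMajoranaFamily M) (g : lp (fun _ : ℕ => ℝ) 2) :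
    HasSum (fun n => (g n : ℂ) • M n) (hM.modeMap g) :=
  (hM.summable_smul (summable_sq_lp g)).hasSum

/-- This reduces mutual anticommutation of modes to ℓ²-orthogonality of their wavefunctions. -/
theorem modeMap_anticomm (hM : IsMajoranaFamily M) (g g' : lp (fun _ : ℕ => ℝ) 2) :
    hM.modeMap g * hM.modeMap g' + hM.modeMap g' * hM.modeMap g =
      ((2 * inner ℝ g g' : ℝ) : ℂ) • (1 : FockOp) := by
  have h := (hM.hasSum_modeMap g).tendsto_sum_nat
  have h' := (hM.hasSum_modeMap g').tendsto_sum_nat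
  refine tendsto_nhds_unique ((h.mul h').add (h'.mul h)) ?_
  simp only [hM.anticomm_sum]
  refine Tendsto.smul_const ?_ _
  refine (continuous_ofReal.tendsto _).comp (Tendsto.const_mul 2 ?_)
  have := (lp.hasSum_inner (𝕜 := ℝ) g g').tendsto_sum_nat
  refine this.congr fun L => Finset.sum_congr rfl fun n _ => ?_
  simp [mul_comm]

theorem modeMap_injective (hM : IsMajoranaFamily M) : Function.Injective hM.modeMap := by
  rw [injective_iff_map_eq_zero]
  intro g hg
  have h := hM.modeMap_anticomm g g
  rw [hg, mul_zero, add_zero] at h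
  have h2 := (smul_eq_zero.1 h.symm).resolve_right one_ne_zero
  have h3 : (2 * inner ℝ g g : ℝ) = 0 := by exact_mod_cast h2
  exact inner_self_eq_zero.1 (by linarith : inner ℝ g g = 0)

end IsMajoranaFamily

/-! ### Commuting with the chain as a Toeplitz kernel condition. -/

/-- The commutators of the `M_k` with the open chains are those of a Toeplitz operator with
coefficients `T`. -/
structure HasToeplitzCommutator (t T : ℤ → ℝ) (M M' : ℕ → FockOp) (c : ℂ) : Prop where
  norm_eq_one : ‖c‖ = 1
  comm : ∀ k L : ℕ, M k * openChain t L - openChain t L * M k =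
    if k < L then c • ∑ n ∈ Finset.range L, (T ((n : ℤ) - k) : ℂ) • M' n else 0

theorem openChain_comm_re (t : ℤ → ℝ) (k L : ℕ) :
    majoranaRe k * openChain t L - openChain t L * majoranaRe k =
    if k < L then (-I) • ∑ n ∈ Finset.range L, (t (-((n : ℤ) - k)) : ℂ) • majoranaIm n
    else 0 := by
  -- Carrying `majoranaRe k` past `majoranaIm n` costs a sign, which turns the commutator into an
  -- anticommutator of two real Majoranas.
  have key (m n : ℕ) : majoranaRe k * (majoranaIm n * majoranaRe m) -
      majoranaIm n * majoranaRe m * majoranaRe k =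
      (if m = k then (-2 : ℂ) else 0) • majoranaIm n := by
    have h1 := eq_neg_of_add_eq_zero_left (majoranaRe_majoranaIm_anticomm k n)
    rw [← mul_assoc, h1, neg_mul, mul_assoc, mul_assoc, ← neg_add', ← mul_add,
      add_comm, majoranaRe_anticomm]
    split_ifs <;> simp
  simp only [openChain, mul_smul_comm, smul_mul_assoc, Finset.mul_sum, Finset.sum_mul,
    ← smul_sub, ← Finset.sum_sub_distrib, key, ite_smul, zero_smul, smul_ite, smul_zero]
  rw [Finset.sum_comm]
  simp only [Finset.sum_ite_eq', Finset.mem_range]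
  split_ifs
  · simp only [Finset.smul_sum, smul_smul]
    refine Finset.sum_congr rfl fun n _ => ?_
    rw [neg_sub]
    congr 1
    ring
  · simp

theorem openChain_comm_im (t : ℤ → ℝ) (k L : ℕ) :
    majoranaIm k * openChain t L - openChain t L * majoranaIm k =
    if k < L then I • ∑ n ∈ Finset.range L, (t ((n : ℤ) - k) : ℂ) • majoranaRe n
    else 0 := by
  have key (m n : ℕ) : majoranaIm k * (majoranaIm n * majoranaRe m) -
      majoranaIm n * majoranaRe m * majoranaIm k =
      (if n = k then (2 : ℂ) else 0) • majoranaRe m := by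
    have h1 := eq_neg_of_add_eq_zero_left (majoranaRe_majoranaIm_anticomm m k)
    rw [mul_assoc (majoranaIm n), h1, mul_neg, sub_neg_eq_add, ← mul_assoc, ← mul_assoc,
      ← add_mul, add_comm, majoranaIm_anticomm]
    split_ifs <;> simp
  simp only [openChain, mul_smul_comm, smul_mul_assoc, Finset.mul_sum, Finset.sum_mul,
    ← smul_sub, ← Finset.sum_sub_distrib, key, ite_smul, zero_smul, smul_ite, smul_zero]
  simp only [Finset.sum_ite_eq', Finset.mem_range]
  split_ifs
  · simp only [Finset.smul_sum, smul_smul]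
    refine Finset.sum_congr rfl fun n _ => ?_
    congr 1
    ring
  · simp

theorem hasToeplitzCommutator_re (t : ℤ → ℝ) :
    HasToeplitzCommutator t (fun j => t (-j)) majoranaRe majoranaIm (-I) :=
  ⟨by simp, openChain_comm_re t⟩

theorem hasToeplitzCommutator_im (t : ℤ → ℝ) :
    HasToeplitzCommutator t t majoranaIm majoranaRe I :=
  ⟨by simp, openChain_comm_im t⟩

namespace HasToeplitzCommutator

variable {t T : ℤ → ℝ} {M M' : ℕ → FockOp} {c : ℂ}

theorem comm_hasSum (h : HasToeplitzCommutator t T M M' c) {g : ℕ → ℝ} {X : FockOp}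
    (hX : HasSum (fun n => (g n : ℂ) • M n) X) (L : ℕ) :
    X * openChain t L - openChain t L * X = c • ∑ n ∈ Finset.range L,
      ((∑ k ∈ Finset.range L, T ((n : ℤ) - k) * g k : ℝ) : ℂ) • M' n := by
  have h1 := (hX.mul_right (openChain t L)).sub (hX.mul_left (openChain t L))
  simp only [smul_mul_assoc, mul_smul_comm, ← smul_sub, h.comm] at h1
  refine h1.unique ?_
  have h2 : c • ∑ n ∈ Finset.range L,
      ((∑ k ∈ Finset.range L, T ((n : ℤ) - k) * g k : ℝ) : ℂ) • M' n =
      ∑ k ∈ Finset.range L, (g k : ℂ) • (if k < L then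
        c • ∑ n ∈ Finset.range L, (T ((n : ℤ) - k) : ℂ) • M' n else 0) := by
    symm
    rw [Finset.sum_congr rfl (g := fun k : ℕ => c • ∑ n ∈ Finset.range L,
      ((T ((n : ℤ) - k) * g k : ℝ) : ℂ) • M' n), ← Finset.smul_sum, Finset.sum_comm]
    · simp only [ofReal_sum, Finset.sum_smul]
    · intro k hk
      rw [if_pos (Finset.mem_range.1 hk), smul_comm, Finset.smul_sum]
      congr 1
      refine Finset.sum_congr rfl fun n _ => ?_
      rw [smul_smul, ofReal_mul, mul_comm]
  rw [h2]
  refine hasSum_sum_of_ne_finset_zero fun k hk => ?_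
  rw [if_neg (by simpa using hk), smul_zero]

theorem summable_toeplitz (hT : Summable fun n => |T n|) {g : ℕ → ℝ}
    (hg : Summable fun n => g n ^ 2) (n : ℤ) : Summable fun k : ℕ => T (n - k) * g k := by
  obtain ⟨B, hB⟩ : ∃ B, ∀ k, |g k| ≤ B := by
    refine ⟨Real.sqrt (∑' k, g k ^ 2), fun k => Real.abs_le_sqrt ?_⟩
    exact hg.le_tsum k fun _ _ => sq_nonneg _
  have h1 : Summable fun k : ℕ => |T (n - k)| :=
    hT.comp_injective (i := fun k : ℕ => n - (k : ℤ)) fun a b hab => by simpa using hab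
  refine Summable.of_norm_bounded (h1.mul_right B) fun k => ?_
  rw [norm_mul]
  exact mul_le_mul_of_nonneg_left (hB k) (norm_nonneg _)

/-- By `norm_sum_sq`, each single coefficient of the commutator is bounded by its norm, which tends
to zero; the `n`-th coefficient tends to the full Toeplitz row as `L → ∞`. Square-summability of `g`
suffices in this direction. -/
theorem toeplitz_eq_zero (h : HasToeplitzCommutator t T M M' c) (hM' : IsMajoranaFamily M')
    (hT : Summable fun n => |T n|) {g : ℕ → ℝ} (hg : Summable fun n => g n ^ 2) {X : FockOp}
    (hX : HasSum (fun n => (g n : ℂ) • M n) X) (hc : CommutesWithChain t X) (n : ℕ) :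
    ∑' k : ℕ, T ((n : ℤ) - k) * g k = 0 := by
  have h1 := (summable_toeplitz hT hg n).hasSum.tendsto_sum_nat
  have h2 := hc.norm
  simp only [norm_zero] at h2
  refine tendsto_nhds_unique h1 ?_
  rw [tendsto_zero_iff_norm_tendsto_zero]
  refine squeeze_zero' (Eventually.of_forall fun L => norm_nonneg _) ?_ h2
  filter_upwards [eventually_gt_atTop n] with L hL
  rw [h.comm_hasSum hX, norm_smul, h.norm_eq_one, one_mul, Real.norm_eq_abs]
  refine abs_le_of_sq_le_sq ?_ (norm_nonneg _)
  rw [hM'.norm_sum_sq]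
  exact Finset.single_le_sum (f := fun n : ℕ => (∑ k ∈ Finset.range L, T ((n : ℤ) - k) * g k) ^ 2)
    (fun _ _ => sq_nonneg _) (Finset.mem_range.2 hL)

theorem sum_toeplitz_le (hT : Summable fun n => |T n|) (k : ℤ) (L : ℕ) :
    ∑ n ∈ Finset.range L, |T ((n : ℤ) - k)| ≤ ∑' j, |T j| := by
  have hinj : Function.Injective fun n : ℕ => (n : ℤ) - k := fun a b hab => by simpa using hab
  have h1 : Summable fun n : ℕ => |T ((n : ℤ) - k)| := hT.comp_injective hinj
  exact (h1.sum_le_tsum _ fun _ _ => abs_nonneg _).trans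
    (tsum_comp_le_tsum_of_inj hT (fun _ => abs_nonneg _) hinj)

/-- As the full rows vanish, each truncated row is minus its tail. Summing the tails over `n` costs
at most `∑ |T_j|` times the ℓ¹ tail of `g`, which is why absolute summability is assumed. -/
theorem commutesWithChain (h : HasToeplitzCommutator t T M M' c) (hM' : IsMajoranaFamily M')
    (hT : Summable fun n => |T n|) {g : ℕ → ℝ} (hg : Summable fun n => |g n|) {X : FockOp}
    (hX : HasSum (fun n => (g n : ℂ) • M n) X)
    (h0 : ∀ n : ℕ, ∑' k : ℕ, T ((n : ℤ) - k) * g k = 0) : CommutesWithChain t X := by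
  have hB : ∀ k, |T k| ≤ ∑' k, |T k| := fun k => hT.le_tsum k fun _ _ => abs_nonneg _
  have hs (n : ℤ) : Summable fun k : ℕ => |T (n - k) * g k| := by
    refine Summable.of_nonneg_of_le (fun _ => abs_nonneg _) (fun k => ?_)
      (hg.mul_left (∑' k, |T k|))
    rw [abs_mul]
    exact mul_le_mul_of_nonneg_right (hB _) (abs_nonneg _)
  have htail : Tendsto (fun L : ℕ => (∑' k, |T k|) * ∑' k : ℕ, |g (k + L)|) atTop (𝓝 0) := by
    have := (tendsto_sum_nat_add fun k => |g k|).const_mul (∑' k, |T k|)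
    rwa [mul_zero] at this
  rw [CommutesWithChain, tendsto_zero_iff_norm_tendsto_zero]
  refine squeeze_zero (fun _ => norm_nonneg _) (fun L => ?_) htail
  rw [h.comm_hasSum hX, norm_smul, h.norm_eq_one, one_mul]
  have hs' (n : ℕ) : Summable fun k : ℕ => |T ((n : ℤ) - (k + L : ℕ)) * g (k + L)| :=
    (summable_nat_add_iff (f := fun k : ℕ => |T ((n : ℤ) - k) * g k|) L).2 (hs n)
  have hrow (n : ℕ) : |∑ k ∈ Finset.range L, T ((n : ℤ) - k) * g k| ≤
      ∑' k : ℕ, |T ((n : ℤ) - (k + L : ℕ)) * g (k + L)| := by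
    have h1 := (Summable.of_abs (hs n)).sum_add_tsum_nat_add L
    rw [h0 n] at h1
    rw [eq_neg_of_add_eq_zero_left h1, abs_neg]
    simpa only [Real.norm_eq_abs] using norm_tsum_le_tsum_norm
      (f := fun k : ℕ => T ((n : ℤ) - (k + L : ℕ)) * g (k + L)) (hs' n)
  calc ‖∑ n ∈ Finset.range L,
        ((∑ k ∈ Finset.range L, T ((n : ℤ) - k) * g k : ℝ) : ℂ) • M' n‖
      ≤ ∑ n ∈ Finset.range L, |∑ k ∈ Finset.range L, T ((n : ℤ) - k) * g k| := by
        refine norm_sum_le_of_le _ fun n _ => ?_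
        rw [norm_smul, hM'.norm_eq_one, mul_one, Complex.norm_real, Real.norm_eq_abs]
    _ ≤ ∑ n ∈ Finset.range L, ∑' k : ℕ, |T ((n : ℤ) - (k + L : ℕ)) * g (k + L)| :=
        Finset.sum_le_sum fun n _ => hrow n
    _ = ∑' k : ℕ, ∑ n ∈ Finset.range L, |T ((n : ℤ) - (k + L : ℕ)) * g (k + L)| :=
        (Summable.tsum_finsetSum (s := Finset.range L)
          (f := fun (n k : ℕ) => |T ((n : ℤ) - (k + L : ℕ)) * g (k + L)|) fun n _ => hs' n).symm
    _ ≤ ∑' k : ℕ, (∑' k, |T k|) * |g (k + L)| := by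
        refine Summable.tsum_le_tsum (fun k => ?_)
          (summable_sum (s := Finset.range L)
            (f := fun (n k : ℕ) => |T ((n : ℤ) - (k + L : ℕ)) * g (k + L)|) fun n _ => hs' n)
          (((summable_nat_add_iff (f := fun k => |g k|) L).2 hg).mul_left _)
        simp only [abs_mul, ← Finset.sum_mul]
        refine mul_le_mul_of_nonneg_right ?_ (abs_nonneg _)
        exact sum_toeplitz_le hT _ _
    _ = (∑' k, |T k|) * ∑' k : ℕ, |g (k + L)| := tsum_mul_left

end HasToeplitzCommutator

/-! ### The Wiener algebra and the Wiener–Lévy theorem. -/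

/-- The Wiener algebra `ℓ¹(ℤ)`: absolutely convergent Fourier series, with convolution. -/
abbrev WienerAlg : Type := lp (fun _ : ℤ => ℂ) 1

abbrev AngleCircle : Type := AddCircle (2 * Real.pi)

instance : Fact (0 < 2 * Real.pi) := ⟨Real.two_pi_pos⟩

namespace WienerAlg

theorem memℓp_iff {a : ℤ → ℂ} : Memℓp a 1 ↔ Summable fun n => ‖a n‖ := by
  rw [memℓp_gen_iff (by norm_num)]
  simp

theorem summable_norm (a : WienerAlg) : Summable fun n => ‖a n‖ := memℓp_iff.1 (lp.memℓp a)

theorem norm_eq (a : WienerAlg) : ‖a‖ = ∑' n, ‖a n‖ := by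
  rw [lp.norm_eq_tsum_rpow (by norm_num)]
  simp

theorem summable_smul_fourier (a : WienerAlg) :
    Summable fun n => a n • (fourier n : C(AngleCircle, ℂ)) := by
  refine Summable.of_norm_bounded a.summable_norm fun n => ?_
  rw [norm_smul, fourier_norm, mul_one]

/-- The sum `∑ a_n e^{inx}` of the Fourier series with coefficients `a`. -/
noncomputable def evalCLM : WienerAlg →L[ℂ] C(AngleCircle, ℂ) :=
  LinearMap.mkContinuous
    { toFun := fun a => ∑' n, a n • (fourier n : C(AngleCircle, ℂ))
      map_add' := fun a b => by
        rw [← (summable_smul_fourier a).tsum_add (summable_smul_fourier b)]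
        simp [add_smul]
      map_smul' := fun c a => by
        rw [RingHom.id_apply, ← (summable_smul_fourier a).tsum_const_smul c]
        simp [mul_smul] }
    1 fun a => by
      rw [one_mul, norm_eq]
      refine tsum_of_norm_bounded a.summable_norm.hasSum fun n => ?_
      rw [norm_smul, fourier_norm, mul_one]

theorem hasSum_evalCLM (a : WienerAlg) :
    HasSum (fun n => a n • (fourier n : C(AngleCircle, ℂ))) (evalCLM a) :=
  (summable_smul_fourier a).hasSum

/-- The `n`-th Fourier coefficient of a continuous function. -/
noncomputable def fourierCoeffCLM (n : ℤ) : C(AngleCircle, ℂ) →L[ℂ] ℂ :=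
  LinearMap.mkContinuous
    { toFun := fun f => fourierCoeff f n
      map_add' := fun f g => by
        rw [ContinuousMap.coe_add, fourierCoeff.add]
        · rfl
        · exact f.continuous.integrable_of_hasCompactSupport
            (HasCompactSupport.of_compactSpace _)
        · exact g.continuous.integrable_of_hasCompactSupport
            (HasCompactSupport.of_compactSpace _)
      map_smul' := fun c f => by
        rw [ContinuousMap.coe_smul, fourierCoeff.const_smul]
        rfl }
    1 fun f => by
      rw [one_mul]
      change ‖fourierCoeff f n‖ ≤ _
      unfold fourierCoeff
      refine (MeasureTheory.norm_integral_le_of_norm_le_const (C := ‖f‖)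
        (Eventually.of_forall fun x => ?_)).trans ?_
      · rw [norm_smul, fourier_apply, Circle.norm_coe, one_mul]
        exact f.norm_coe_le_norm x
      · simp

theorem fourierCoeff_evalCLM (a : WienerAlg) (n : ℤ) : fourierCoeff (evalCLM a) n = a n := by
  have h := (hasSum_evalCLM a).mapL (fourierCoeffCLM n)
  simp only [map_smul] at h
  have h2 (k : ℤ) : fourierCoeffCLM n (fourier k) = if k = n then 1 else 0 := by
    change fourierCoeff (fourier k) n = _
    rw [fourierCoeff_fourier, Pi.single_apply]
    simp [eq_comm]
  simp only [h2, smul_eq_mul, mul_ite, mul_one, mul_zero] at h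
  refine h.unique ?_
  convert hasSum_ite_eq n (a n) using 2 with k
  split_ifs with hk
  · rw [hk]
  · rfl

/-- Identities between elements of ℓ¹(ℤ), the ring axioms included, can thus be checked as
identities of functions on the circle. -/
theorem evalCLM_injective : Function.Injective evalCLM := by
  intro a b h
  ext n
  rw [← fourierCoeff_evalCLM, h, fourierCoeff_evalCLM]

/-- Translation of the coefficients, i.e. multiplication by `e^{ikx}`. -/
noncomputable def shift (k : ℤ) (a : WienerAlg) : WienerAlg :=
  ⟨fun n => a (n - k), memℓp_iff.2 (a.summable_norm.comp_injective (sub_left_injective))⟩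

theorem shift_apply (k : ℤ) (a : WienerAlg) (n : ℤ) : shift k a n = a (n - k) := rfl

theorem norm_shift (k : ℤ) (a : WienerAlg) : ‖shift k a‖ = ‖a‖ := by
  rw [norm_eq, norm_eq]
  exact (Equiv.subRight k).tsum_eq fun n => ‖a n‖

theorem evalCLM_shift (k : ℤ) (a : WienerAlg) :
    evalCLM (shift k a) = fourier k * evalCLM a := by
  have h := (hasSum_evalCLM a).mul_left (fourier k)
  refine (hasSum_evalCLM _).unique ?_
  rw [← (Equiv.addRight k).hasSum_iff]
  have h2 : (fun n => shift k a n • (fourier n : C(AngleCircle, ℂ))) ∘ Equiv.addRight k =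
      fun n => fourier k * a n • fourier n := by
    funext n
    ext x
    simp [shift_apply, mul_comm]
  rwa [h2]

theorem summable_smul_shift (a b : WienerAlg) : Summable fun k => a k • shift k b := by
  refine Summable.of_norm_bounded (a.summable_norm.mul_right ‖b‖) fun k => ?_
  rw [norm_smul, norm_shift]

noncomputable instance : Mul WienerAlg := ⟨fun a b => ∑' k, a k • shift k b⟩

theorem hasSum_mul (a b : WienerAlg) : HasSum (fun k => a k • shift k b) (a * b) :=
  (summable_smul_shift a b).hasSum

noncomputable instance : One WienerAlg := ⟨lp.single 1 0 1⟩

theorem evalCLM_mul (a b : WienerAlg) : evalCLM (a * b) = evalCLM a * evalCLM b := by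
  have h := (hasSum_mul a b).mapL evalCLM
  simp only [map_smul, evalCLM_shift] at h
  have h2 := (hasSum_evalCLM a).mul_right (evalCLM b)
  simp only [smul_mul_assoc] at h2
  exact h.unique h2

theorem evalCLM_single (n : ℤ) (c : ℂ) : evalCLM (lp.single 1 n c) = c • fourier n := by
  refine (hasSum_evalCLM _).unique ?_
  convert hasSum_ite_eq n (c • (fourier n : C(AngleCircle, ℂ))) using 2 with k
  split_ifs with h
  · rw [h, lp.single_apply_self]
  · rw [lp.single_apply_ne _ _ _ h, zero_smul]

theorem evalCLM_one : evalCLM (1 : WienerAlg) = 1 := by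
  change evalCLM (lp.single 1 0 1) = 1
  rw [evalCLM_single]
  ext x
  simp

noncomputable instance : NormedCommRing WienerAlg where
  mul_assoc a b c := evalCLM_injective (by simp only [evalCLM_mul, mul_assoc])
  mul_comm a b := evalCLM_injective (by simp only [evalCLM_mul, mul_comm])
  one_mul a := evalCLM_injective (by simp only [evalCLM_mul, evalCLM_one, one_mul])
  mul_one a := evalCLM_injective (by simp only [evalCLM_mul, evalCLM_one, mul_one])
  left_distrib a b c := evalCLM_injective (by simp only [evalCLM_mul, map_add, mul_add])
  right_distrib a b c := evalCLM_injective (by simp only [evalCLM_mul, map_add, add_mul])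
  zero_mul a := evalCLM_injective (by simp only [evalCLM_mul, map_zero, zero_mul])
  mul_zero a := evalCLM_injective (by simp only [evalCLM_mul, map_zero, mul_zero])
  dist_eq a b := dist_eq_norm_neg_add a b
  norm_mul_le a b := by
    refine tsum_of_norm_bounded (g := fun k => ‖a k‖ * ‖b‖) ?_ fun k => ?_
    · rw [norm_eq a]
      exact a.summable_norm.hasSum.mul_right _
    · rw [norm_smul, norm_shift]

noncomputable instance : NormedAlgebra ℂ WienerAlg where
  __ := Algebra.ofModule
    (fun c a b => evalCLM_injective (by simp only [evalCLM_mul, map_smul, smul_mul_assoc]))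
    (fun c a b => evalCLM_injective (by simp only [evalCLM_mul, map_smul, mul_smul_comm]))
  norm_smul_le c a := norm_smul_le c a

/-- Evaluation of Fourier series, as a homomorphism of algebras. -/
noncomputable def eval : WienerAlg →ₐ[ℂ] C(AngleCircle, ℂ) :=
  AlgHom.ofLinearMap evalCLM evalCLM_one evalCLM_mul

theorem eval_injective : Function.Injective eval := evalCLM_injective

theorem hasSum_eval (a : WienerAlg) :
    HasSum (fun n => a n • (fourier n : C(AngleCircle, ℂ))) (eval a) := hasSum_evalCLM a

theorem fourierCoeff_eval (a : WienerAlg) (n : ℤ) : fourierCoeff (eval a) n = a n :=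
  fourierCoeff_evalCLM a n

theorem mul_apply (a b : WienerAlg) (n : ℤ) : (a * b) n = ∑' k, a k * b (n - k) := by
  have h := (hasSum_mul a b).mapL (lp.evalCLM ℂ (fun _ : ℤ => ℂ) 1 n)
  exact h.tsum_eq.symm

/-- The monomial `c e^{inx}`. -/
noncomputable def monomial (n : ℤ) (c : ℂ) : WienerAlg := lp.single 1 n c

theorem eval_monomial (n : ℤ) (c : ℂ) : eval (monomial n c) = c • fourier n := evalCLM_single n c

theorem monomial_apply (n : ℤ) (c : ℂ) (k : ℤ) : monomial n c k = if k = n then c else 0 := by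
  unfold monomial
  split_ifs with h
  · rw [h, lp.single_apply_self]
  · rw [lp.single_apply_ne _ _ _ h]

theorem monomial_mul (n : ℤ) (a : WienerAlg) : monomial n 1 * a = shift n a := by
  apply eval_injective
  rw [map_mul, eval_monomial, one_smul]
  exact (evalCLM_shift n a).symm

end WienerAlg

theorem fourier_coe (n : ℤ) (x : ℝ) : (fourier n : C(AngleCircle, ℂ)) x = exp (x * I) ^ n := by
  rw [fourier_coe_apply, ← Complex.exp_int_mul]
  congr 1
  have : (Real.pi : ℂ) ≠ 0 := by exact_mod_cast Real.pi_ne_zero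
  push_cast
  field_simp

namespace WienerAlg

theorem hasSum_eval_apply (a : WienerAlg) (x : AngleCircle) :
    HasSum (fun n => a n * (fourier n : C(AngleCircle, ℂ)) x) (eval a x) :=
  (hasSum_eval a).mapL (ContinuousMap.evalCLM ℂ x)

theorem monomial_mul_monomial (m n : ℤ) : monomial m 1 * monomial n 1 = monomial (m + n) 1 := by
  apply eval_injective
  ext x
  simp [eval_monomial]

theorem monomial_zero : monomial 0 1 = 1 := rfl

theorem norm_monomial (n : ℤ) (c : ℂ) : ‖monomial n c‖ = ‖c‖ := lp.norm_single (by norm_num) _ _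

instance : NormOneClass WienerAlg := ⟨by rw [← monomial_zero, norm_monomial, norm_one]⟩

instance : Nontrivial WienerAlg := NormOneClass.nontrivial

/-- The characters of the Wiener algebra are the evaluations at points of the circle. -/
theorem exists_character_eq_eval (χ : WeakDual.characterSpace ℂ WienerAlg) :
    ∃ x : AngleCircle, ∀ a, χ a = eval a x := by
  have hadd (m n : ℤ) : χ (monomial (m + n) 1) = χ (monomial m 1) * χ (monomial n 1) := by
    rw [← monomial_mul_monomial, map_mul]
  have h0 : χ (monomial 0 1) = 1 := map_one χ
  have hle (n : ℤ) : ‖χ (monomial n 1)‖ ≤ 1 := by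
    have := AlgHom.norm_apply_le_self χ (monomial n 1)
    rwa [norm_monomial, norm_one] at this
  have hinv : χ (monomial (-1) 1) * χ (monomial 1 1) = 1 := by
    rw [← hadd, neg_add_cancel, h0]
  -- Both `e^{ix}` and its inverse have norm one and a character is contractive, so the value at
  -- `e^{ix}` is unimodular and names a point of the circle.
  have hone : ‖χ (monomial 1 1)‖ = 1 := by
    refine le_antisymm (hle 1) ?_
    have h1 := congrArg norm hinv
    rw [norm_mul, norm_one] at h1
    rw [← h1]
    exact mul_le_of_le_one_left (norm_nonneg _) (hle _)
  have hne : χ (monomial 1 1) ≠ 0 := fun h => by simp [h] at hone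
  refine ⟨((arg (χ (monomial 1 1)) : ℝ) : AngleCircle), ?_⟩
  set x : AngleCircle := ((arg (χ (monomial 1 1)) : ℝ) : AngleCircle)
  have hx : (fourier 1 : C(AngleCircle, ℂ)) x = χ (monomial 1 1) := by
    rw [fourier_coe, zpow_one]
    have := norm_mul_exp_arg_mul_I (χ (monomial 1 1))
    rwa [hone, ofReal_one, one_mul] at this
  have hmon (n : ℤ) : χ (monomial n 1) = (fourier n : C(AngleCircle, ℂ)) x := by
    induction n using Int.induction_on with
    | zero => simp [h0]
    | succ n ih => rw [hadd, fourier_add, ih, hx]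
    | pred n ih =>
      apply mul_right_cancel₀ hne
      rw [← hadd, sub_add_cancel, ih, ← hx, ← fourier_add, sub_add_cancel]
  intro a
  have h1 := (lp.hasSum_single (E := fun _ : ℤ => ℂ) (p := 1) (by norm_num) a).map χ
    (map_continuous χ)
  refine h1.unique ?_
  convert hasSum_eval_apply a x using 1
  funext n
  have h2 : (lp.single 1 n (a n) : WienerAlg) = a n • monomial n 1 := by
    rw [monomial, ← lp.single_smul, smul_eq_mul, mul_one]
  rw [Function.comp_apply, h2, map_smul, hmon, smul_eq_mul]

theorem spectralRadius_le {a : WienerAlg} {ρ : ℝ} (h : ∀ x, ‖eval a x‖ ≤ ρ) :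
    spectralRadius ℂ a ≤ ENNReal.ofReal ρ := by
  refine iSup₂_le fun z hz => ?_
  obtain ⟨χ, rfl⟩ := WeakDual.CharacterSpace.mem_spectrum_iff_exists.1 hz
  obtain ⟨x, hx⟩ := exists_character_eq_eval χ
  rw [hx, ← enorm_eq_nnnorm, ← ofReal_norm]
  exact ENNReal.ofReal_le_ofReal (h x)

/-- Since characters are point evaluations, a sup-norm bound controls the spectral radius, and
Gelfand's formula converts it into geometric decay of powers in the larger ℓ¹ norm. -/
theorem summable_norm_pow {a : WienerAlg} {ρ : ℝ} (hρ : ρ < 1) (h : ∀ x, ‖eval a x‖ ≤ ρ) :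
    Summable fun n : ℕ => ‖a ^ n‖ := by
  have hρ0 : 0 ≤ ρ := (norm_nonneg _).trans (h 0)
  obtain ⟨r, hr1, hr2⟩ := exists_between hρ
  have h1 := spectrum.pow_norm_pow_one_div_tendsto_nhds_spectralRadius a
  have h2 : spectralRadius ℂ a < ENNReal.ofReal r :=
    (spectralRadius_le h).trans_lt ((ENNReal.ofReal_lt_ofReal_iff (hρ0.trans_lt hr1)).2 hr1)
  have h3 := (h1.eventually_lt_const h2).and (eventually_gt_atTop 0)
  refine Summable.of_norm_bounded_eventually_nat
    (summable_geometric_of_lt_one (hρ0.trans hr1.le) hr2) ?_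
  filter_upwards [h3] with n hn
  have h4 := (ENNReal.ofReal_lt_ofReal_iff (hρ0.trans_lt hr1)).1 hn.1
  have hn0 : (n : ℝ) ≠ 0 := by exact_mod_cast hn.2.ne'
  rw [norm_norm, ← Real.rpow_natCast r n]
  calc ‖a ^ n‖ = (‖a ^ n‖ ^ (1 / n : ℝ)) ^ (n : ℝ) := by
        rw [← Real.rpow_mul (norm_nonneg _), one_div_mul_cancel hn0, Real.rpow_one]
    _ ≤ r ^ (n : ℝ) := Real.rpow_le_rpow (by positivity) h4.le (by positivity)

theorem exists_eval_eq_log {a : WienerAlg} {ρ : ℝ} (hρ : ρ < 1) (h : ∀ x, ‖eval a x‖ ≤ ρ) :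
    ∃ b : WienerAlg, ∀ x, eval b x = log (1 + eval a x) := by
  have hs : Summable fun n : ℕ => ((-1 : ℂ) ^ (n + 1) / n) • a ^ n := by
    refine Summable.of_norm_bounded (summable_norm_pow hρ h) fun n => ?_
    rw [norm_smul]
    refine mul_le_of_le_one_left (norm_nonneg _) ?_
    rw [norm_div, norm_pow, norm_neg, norm_one, one_pow, Complex.norm_natCast]
    -- The term `n = 0` of the logarithm series vanishes because division by zero gives zero.
    rcases n.eq_zero_or_pos with rfl | hn
    · simp
    · exact div_le_one_of_le₀ (by exact_mod_cast hn) (by positivity)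
  refine ⟨∑' n : ℕ, ((-1 : ℂ) ^ (n + 1) / n) • a ^ n, fun x => ?_⟩
  have h1 := (hs.hasSum.mapL evalCLM).mapL (ContinuousMap.evalCLM ℂ x)
  refine h1.unique ?_
  convert Complex.hasSum_taylorSeries_log ((h x).trans_lt hρ) using 1
  funext n
  change (eval (((-1 : ℂ) ^ (n + 1) / n) • a ^ n)) x = _
  rw [map_smul, map_pow, ContinuousMap.smul_apply, ContinuousMap.pow_apply, smul_eq_mul]
  ring

theorem eval_exp (a : WienerAlg) (x : AngleCircle) :
    eval (NormedSpace.exp a) x = exp (eval a x) := by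
  have h1 := ((NormedSpace.exp_series_hasSum_exp' (𝕂 := ℂ) a).mapL evalCLM).mapL
    (ContinuousMap.evalCLM ℂ x)
  refine h1.unique ?_
  rw [Complex.exp_eq_exp_ℂ]
  have h2 := NormedSpace.exp_series_hasSum_exp' (𝕂 := ℂ) (eval a x)
  have h3 : (fun n : ℕ => ((n.factorial : ℂ)⁻¹) • (eval a x) ^ n) = fun n : ℕ =>
      ContinuousMap.evalCLM ℂ x (evalCLM ((n.factorial : ℂ)⁻¹ • a ^ n)) := by
    funext n
    symm
    change (eval ((n.factorial : ℂ)⁻¹ • a ^ n)) x = _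
    rw [map_smul, map_pow, ContinuousMap.smul_apply, ContinuousMap.pow_apply]
  rw [h3] at h2
  exact h2

theorem denseRange_eval : DenseRange eval := by
  have h1 : Submodule.span ℂ (range (fourier (T := 2 * Real.pi))) ≤
      LinearMap.range eval.toLinearMap := by
    rw [Submodule.span_le]
    rintro _ ⟨n, rfl⟩
    exact ⟨monomial n 1, by simp [eval_monomial]⟩
  have h2 := span_fourier_closure_eq_top (T := 2 * Real.pi)
  intro f
  have h3 : f ∈ (Submodule.span ℂ (range (fourier (T := 2 * Real.pi)))).topologicalClosure := by
    rw [h2]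
    trivial
  exact closure_mono h1 h3

/-- Wiener–Lévy: a continuous logarithm of an absolutely convergent Fourier series is itself
an absolutely convergent Fourier series. -/
theorem exists_eval_eq_of_exp_eq {a : WienerAlg} {v : C(AngleCircle, ℂ)}
    (h : ∀ x, exp (v x) = eval a x) : ∃ b : WienerAlg, eval b = v := by
  -- With `P` in the algebra within `1/4` of `v`, the element `a e^{-P}` evaluates to `e^{v-P}`,
  -- within `1/2` of `1`, so its logarithm series converges in the algebra.
  obtain ⟨P, hP⟩ := denseRange_eval.exists_dist_lt v (by norm_num : (0 : ℝ) < 1 / 4)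
  have hδ (x : AngleCircle) : ‖v x - eval P x‖ ≤ 1 / 4 := by
    rw [← ContinuousMap.sub_apply]
    rw [dist_eq_norm] at hP
    exact (ContinuousMap.norm_coe_le_norm _ x).trans hP.le
  have hw (x : AngleCircle) :
      eval (a * NormedSpace.exp (-P) - 1) x = exp (v x - eval P x) - 1 := by
    rw [map_sub, map_mul, map_one, ContinuousMap.sub_apply, ContinuousMap.mul_apply, eval_exp,
      ← h x, ← Complex.exp_add, map_neg]
    rfl
  obtain ⟨b, hb⟩ := exists_eval_eq_log (a := a * NormedSpace.exp (-P) - 1) (ρ := 1 / 2)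
    (by norm_num) fun x => by
      rw [hw]
      refine (Complex.norm_exp_sub_one_le ((hδ x).trans (by norm_num))).trans ?_
      linarith [hδ x]
  refine ⟨P + b, ?_⟩
  ext x
  -- The imaginary part stays below `π`, so the principal logarithm of `e^{v-P}` is `v - P` itself.
  have him := (Complex.abs_im_le_norm (v x - eval P x)).trans (hδ x)
  have hpi := Real.pi_gt_three
  rw [abs_le] at him
  rw [map_add, ContinuousMap.add_apply, hb, hw, add_sub_cancel,
    Complex.log_exp (by linarith) (by linarith), add_sub_cancel]

/-! ### One-sided subalgebras, symmetries of coefficients, and logarithms of the symbol. -/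

/-- Fourier series without negative frequencies. -/
def nonnegPart : Subalgebra ℂ WienerAlg where
  carrier := {a | ∀ n < 0, a n = 0}
  mul_mem' {a b} ha hb n hn := by
    rw [mul_apply]
    refine (tsum_congr fun k => ?_).trans tsum_zero
    rcases lt_or_ge k 0 with hk | hk
    · rw [ha k hk, zero_mul]
    · rw [hb _ (by lia), mul_zero]
  add_mem' {a b} ha hb n hn := by
    change a n + b n = 0
    rw [ha n hn, hb n hn, add_zero]
  algebraMap_mem' c n hn := by
    rw [Algebra.algebraMap_eq_smul_one, ← monomial_zero]
    change c * monomial 0 1 n = 0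
    rw [monomial_apply, if_neg hn.ne, mul_zero]

/-- Fourier series without positive frequencies. -/
def nonposPart : Subalgebra ℂ WienerAlg where
  carrier := {a | ∀ n, 0 < n → a n = 0}
  mul_mem' {a b} ha hb n hn := by
    rw [mul_apply]
    refine (tsum_congr fun k => ?_).trans tsum_zero
    rcases lt_or_ge 0 k with hk | hk
    · rw [ha k hk, zero_mul]
    · rw [hb _ (by lia), mul_zero]
  add_mem' {a b} ha hb n hn := by
    change a n + b n = 0
    rw [ha n hn, hb n hn, add_zero]
  algebraMap_mem' c n hn := by
    rw [Algebra.algebraMap_eq_smul_one, ← monomial_zero]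
    change c * monomial 0 1 n = 0
    rw [monomial_apply, if_neg hn.ne', mul_zero]

theorem mem_nonnegPart {a : WienerAlg} : a ∈ nonnegPart ↔ ∀ n < 0, a n = 0 := Iff.rfl

theorem mem_nonposPart {a : WienerAlg} : a ∈ nonposPart ↔ ∀ n, 0 < n → a n = 0 := Iff.rfl

theorem isClosed_setOf_apply_eq_zero (n : ℤ) : IsClosed {a : WienerAlg | a n = 0} :=
  isClosed_eq (lp.evalCLM ℂ (fun _ : ℤ => ℂ) 1 n).continuous continuous_const

theorem isClosed_nonnegPart : IsClosed (nonnegPart : Set WienerAlg) := by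
  have : (nonnegPart : Set WienerAlg) = ⋂ n : ℤ, ⋂ _ : n < 0, {a | a n = 0} := by
    ext a
    simp [mem_nonnegPart]
  rw [this]
  exact isClosed_iInter fun n => isClosed_iInter fun _ => isClosed_setOf_apply_eq_zero n

theorem isClosed_nonposPart : IsClosed (nonposPart : Set WienerAlg) := by
  have : (nonposPart : Set WienerAlg) = ⋂ n : ℤ, ⋂ _ : 0 < n, {a | a n = 0} := by
    ext a
    simp [mem_nonposPart]
  rw [this]
  exact isClosed_iInter fun n => isClosed_iInter fun _ => isClosed_setOf_apply_eq_zero n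

theorem exp_mem_of_isClosed {s : Subalgebra ℂ WienerAlg} (hs : IsClosed (s : Set WienerAlg))
    {a : WienerAlg} (ha : a ∈ s) : NormedSpace.exp a ∈ s := by
  rw [NormedSpace.exp_eq_tsum ℂ]
  exact tsum_mem hs fun n => s.smul_mem (pow_mem ha n) _

theorem exp_mul_exp_neg (a : WienerAlg) : NormedSpace.exp a * NormedSpace.exp (-a) = 1 := by
  apply eval_injective
  ext x
  rw [map_mul, ContinuousMap.mul_apply, eval_exp, eval_exp, ← Complex.exp_add, map_neg,
    ContinuousMap.neg_apply, add_neg_cancel, Complex.exp_zero, map_one, ContinuousMap.one_apply]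

/-- Complex conjugation of the coefficients. -/
noncomputable def conjCoeff (a : WienerAlg) : WienerAlg :=
  ⟨fun n => (starRingEnd ℂ) (a n), memℓp_iff.2 (by simpa using a.summable_norm)⟩

theorem conjCoeff_apply (a : WienerAlg) (n : ℤ) : conjCoeff a n = (starRingEnd ℂ) (a n) := rfl

theorem eval_conjCoeff (a : WienerAlg) (x : AngleCircle) :
    eval (conjCoeff a) x = (starRingEnd ℂ) (eval a (-x)) := by
  refine (hasSum_eval_apply _ x).unique ?_
  have h := (hasSum_eval_apply a (-x)).map (starRingEnd ℂ) Complex.continuous_conj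
  convert h using 1
  funext n
  rw [conjCoeff_apply, Function.comp_apply, map_mul]
  congr 1
  rw [← fourier_neg]
  simp

/-- Reflection `n ↦ -n` of the coefficients. -/
noncomputable def reflect (a : WienerAlg) : WienerAlg :=
  ⟨fun n => a (-n), memℓp_iff.2 (a.summable_norm.comp_injective neg_injective)⟩

theorem reflect_apply (a : WienerAlg) (n : ℤ) : reflect a n = a (-n) := rfl

theorem eval_reflect (a : WienerAlg) (x : AngleCircle) : eval (reflect a) x = eval a (-x) := by
  refine (hasSum_eval_apply _ x).unique ?_
  have h := (Equiv.neg ℤ).hasSum_iff.2 (hasSum_eval_apply a (-x))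
  convert h using 1
  funext n
  simp [reflect_apply]

end WienerAlg

/-- Such an `f` is `2πi` times a continuous integer-valued function on a connected space. Hence two
continuous logarithms of one function differ by a constant. -/
theorem eq_of_exp_eq_one {f : C(AngleCircle, ℂ)} (h : ∀ x, exp (f x) = 1) (x y : AngleCircle) :
    f x = f y := by
  have h1 (x : AngleCircle) : ∃ n : ℤ, f x = n * (2 * Real.pi * I) := Complex.exp_eq_one_iff.1 (h x)
  choose n hn using h1
  have hc : Continuous n := by
    rw [Int.isClosedEmbedding_coe_real.isEmbedding.continuous_iff]
    have h2 : ((↑) : ℤ → ℝ) ∘ n = fun x => (f x).im / (2 * Real.pi) := by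
      funext x
      rw [hn x]
      have := Real.pi_ne_zero
      simp
    rw [h2]
    fun_prop
  rw [hn x, hn y, isPreconnected_univ.constant hc.continuousOn (mem_univ x) (mem_univ y)]

theorem circleCoeff_eq_of_eval {h : ℂ → ℂ} {a : WienerAlg}
    (ha : ∀ x : ℝ, h (exp (x * I)) = WienerAlg.eval a x) (k : ℤ) : circleCoeff h k = a k := by
  rw [← WienerAlg.fourierCoeff_eval, fourierCoeff_eq_intervalIntegral _ _ 0, circleCoeff,
    circleIntegral, zero_add]
  have hpi : (Real.pi : ℂ) ≠ 0 := by exact_mod_cast Real.pi_ne_zero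
  have h1 (x : ℝ) : deriv (circleMap 0 1) x •
      (h (circleMap 0 1 x) * circleMap 0 1 x ^ (-(k + 1))) =
      I * ((fourier (-k) : C(AngleCircle, ℂ)) x • WienerAlg.eval a x) := by
    have h2 : circleMap 0 1 x = exp (x * I) := by simp [circleMap]
    rw [deriv_circleMap, h2, ha, fourier_coe, smul_eq_mul, smul_eq_mul, neg_add,
      zpow_add₀ (exp_ne_zero _), zpow_neg_one]
    field_simp [exp_ne_zero]
  simp only [h1]
  rw [intervalIntegral.integral_const_mul, Complex.real_smul, ← mul_assoc]
  congr 1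
  push_cast
  field_simp

namespace WienerAlg

/-- The absolutely convergent Fourier series with real coefficients `T`. -/
noncomputable def ofReal {T : ℤ → ℝ} (hT : Summable fun n => |T n|) : WienerAlg :=
  ⟨fun n => (T n : ℂ), memℓp_iff.2 (by simpa using hT)⟩

theorem ofReal_apply {T : ℤ → ℝ} (hT : Summable fun n => |T n|) (n : ℤ) :
    ofReal hT n = T n := rfl

theorem eval_ofReal {T : ℤ → ℝ} (hT : Summable fun n => |T n|) (x : ℝ) :
    eval (ofReal hT) x = symbol T (exp (x * I)) := by
  rw [← (hasSum_eval_apply _ _).tsum_eq, symbol]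
  simp only [fourier_coe, ofReal_apply]

theorem exp_mul_I_mem_sphere (x : ℝ) : exp (x * I) ∈ Metric.sphere (0 : ℂ) 1 := by
  simp [Complex.norm_exp_ofReal_mul_I]

/-- A continuous function on the unit circle, as a function of the angle. -/
noncomputable def angleFun {V : ℂ → ℂ} (hV : ContinuousOn V (Metric.sphere 0 1)) :
    C(AngleCircle, ℂ) where
  toFun x := V ((fourier 1 : C(AngleCircle, ℂ)) x)
  continuous_toFun := hV.comp_continuous (map_continuous _) fun x => by
    rw [mem_sphere_zero_iff_norm, fourier_apply, Circle.norm_coe]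

theorem angleFun_coe {V : ℂ → ℂ} (hV : ContinuousOn V (Metric.sphere 0 1)) (x : ℝ) :
    angleFun hV x = V (exp (x * I)) := by
  change V ((fourier 1 : C(AngleCircle, ℂ)) x) = _
  rw [fourier_coe, zpow_one]

/-- The part of a Fourier series with positive frequencies. -/
noncomputable def posPart (a : WienerAlg) : WienerAlg :=
  ⟨fun n => if 0 < n then a n else 0, memℓp_iff.2 (Summable.of_nonneg_of_le
    (fun n => norm_nonneg _) (fun n => by split_ifs <;> simp) a.summable_norm)⟩

theorem posPart_apply (a : WienerAlg) (n : ℤ) : posPart a n = if 0 < n then a n else 0 := rfl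

theorem eval_posPart (a : WienerAlg) (x : ℝ) :
    eval (posPart a) x = ∑' k : ℕ, a ((k : ℤ) + 1) * exp (x * I) ^ ((k : ℤ) + 1) := by
  rw [← (hasSum_eval_apply _ _).tsum_eq]
  have hinj : Function.Injective fun k : ℕ => (k : ℤ) + 1 := fun a b h => by simpa using h
  rw [← hinj.tsum_eq]
  · refine tsum_congr fun k => ?_
    rw [posPart_apply, if_pos (by omega), fourier_coe]
  · intro n hn
    have h0 : 0 < n := by
      by_contra h0
      simp [posPart_apply, h0] at hn
    exact ⟨(n - 1).toNat, by dsimp only; omega⟩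

/-- By Wiener–Lévy, `V` has absolutely summable Fourier coefficients, so on the circle the series in
the Wiener–Hopf factors converge absolutely. -/
theorem exists_eval_eq_log_symbol {T : ℤ → ℝ} (hT : Summable fun n => |T n|) {w : ℤ}
    {V : ℂ → ℂ} (hV : IsContinuousLog (symbol T) (-w) V) :
    ∃ v : WienerAlg, (∀ x : ℝ, eval v x = V (exp (x * I))) ∧
      NormedSpace.exp v = monomial w 1 * ofReal hT := by
  have key (x : AngleCircle) : exp (angleFun hV.1 x) = eval (monomial w 1 * ofReal hT) x := by
    obtain ⟨x, rfl⟩ := QuotientAddGroup.mk_surjective x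
    rw [angleFun_coe, hV.2 _ (exp_mul_I_mem_sphere x), neg_neg, map_mul, ContinuousMap.mul_apply,
      eval_monomial, one_smul, eval_ofReal, fourier_coe]
  obtain ⟨v, hv⟩ := exists_eval_eq_of_exp_eq key
  refine ⟨v, fun x => by rw [hv, angleFun_coe], eval_injective ?_⟩
  ext x
  rw [eval_exp, hv, key]

/-- Conjugating the coefficients of `v` gives another logarithm of the same real-coefficient series.
The two differ by a constant, which only touches frequency zero; this makes the coefficients of `1 /
b₊` real. -/
theorem conjCoeff_posPart_of_exp {T : ℤ → ℝ} (hT : Summable fun n => |T n|) {w : ℤ}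
    {v : WienerAlg} (hv : NormedSpace.exp v = monomial w 1 * ofReal hT) :
    conjCoeff (posPart v) = posPart v := by
  have h1 : conjCoeff (monomial w 1 * ofReal hT) = monomial w 1 * ofReal hT := by
    ext n
    rw [monomial_mul, conjCoeff_apply, shift_apply, ofReal_apply, Complex.conj_ofReal]
  have h2 (x : AngleCircle) : exp (eval (conjCoeff v - v) x) = 1 := by
    rw [map_sub, ContinuousMap.sub_apply, eval_conjCoeff, Complex.exp_sub, Complex.exp_conj,
      ← eval_exp, ← eval_exp, hv, ← eval_conjCoeff, h1]
    refine div_self ?_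
    rw [← hv, eval_exp]
    exact exp_ne_zero _
  have h3 : conjCoeff v - v = monomial 0 (eval (conjCoeff v - v) 0) := by
    apply eval_injective
    ext x
    rw [eval_monomial, ContinuousMap.smul_apply, fourier_zero, smul_eq_mul, mul_one]
    exact eq_of_exp_eq_one h2 _ _
  ext n
  rw [conjCoeff_apply, posPart_apply]
  split_ifs with hn
  · have h4 : (conjCoeff v - v) n = 0 := by
      rw [h3, monomial_apply, if_neg hn.ne']
    exact sub_eq_zero.1 h4
  · simp

theorem conjCoeff_exp {a : WienerAlg} (ha : conjCoeff a = a) :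
    conjCoeff (NormedSpace.exp a) = NormedSpace.exp a := by
  apply eval_injective
  ext x
  rw [eval_conjCoeff, eval_exp, eval_exp, ← Complex.exp_conj, ← eval_conjCoeff, ha]

theorem conjCoeff_neg (a : WienerAlg) : conjCoeff (-a) = -conjCoeff a := by
  ext n
  exact map_neg (starRingEnd ℂ) _

/-- Convolution with a one-sided sequence. -/
theorem mul_apply_of_nonneg (a : WienerAlg) {b : WienerAlg} (hb : b ∈ nonnegPart) (n : ℤ) :
    (a * b) n = ∑' k : ℕ, a (n - k) * b k := by
  rw [mul_comm, mul_apply, ← Nat.cast_injective.tsum_eq (f := fun k : ℤ => b k * a (n - k))]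
  · exact tsum_congr fun k => mul_comm _ _
  · intro k hk
    have h0 : 0 ≤ k := by
      by_contra h0
      simp [hb k (not_le.1 h0)] at hk
    exact ⟨k.toNat, by omega⟩

theorem eq_sum_shift {a h P : WienerAlg} (hah : a = P * h) {w : ℕ} (hP : P ∈ nonnegPart)
    (hPw : ∀ n : ℤ, w ≤ n → P n = 0) (n : ℤ) :
    a n = ∑ m : Fin w, P (m : ℕ) * h (n - (m : ℕ)) := by
  rw [hah, mul_comm, mul_apply_of_nonneg _ hP, tsum_eq_sum (s := Finset.range w),
    Finset.sum_range]
  · exact Finset.sum_congr rfl fun m _ => mul_comm _ _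
  · intro k hk
    rw [hPw k (by simpa using hk), mul_zero]

end WienerAlg

/-! ### Wiener–Hopf factorisation and the Toeplitz kernel. -/

open WienerAlg in
/-- Wiener–Hopf factorisation, and the kernel of the Toeplitz operator of a symbol with winding
number `-w ≤ 0`: it is spanned by the first `w` translates of the coefficients of `1 / b₊`. -/
theorem exists_wienerHopf {T : ℤ → ℝ} (hT : Summable fun n => |T n|) {w : ℕ} {V : ℂ → ℂ}
    (hV : IsContinuousLog (symbol T) (-(w : ℤ)) V) :
    ∃ h : ℤ → ℝ, (Summable fun n => |h n|) ∧
      (∀ k, circleCoeff (fun z => (wienerHopfPlus V z)⁻¹) k = h k) ∧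
      (∀ m : Fin w, ∀ n : ℕ, ∑' k : ℕ, T ((n : ℤ) - k) * h ((k : ℤ) - (m : ℕ)) = 0) ∧
      (∀ c : Fin w → ℝ, (∀ n : ℕ, ∑ m : Fin w, c m * h ((n : ℤ) - (m : ℕ)) = 0) → c = 0) ∧
      (∀ g : ℕ → ℝ, (Summable fun n => |g n|) →
        (∀ n : ℕ, ∑' k : ℕ, T ((n : ℤ) - k) * g k = 0) →
        ∃ c : Fin w → ℝ, ∀ n : ℕ, g n = ∑ m : Fin w, c m * h ((n : ℤ) - (m : ℕ))) := by
  obtain ⟨v, hvV, hv⟩ := exists_eval_eq_log_symbol hT hV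
  -- `A` is the logarithm of `b₊`; the constant `V_0` is absorbed into `B`, which is harmless as
  -- `e^B` only needs nonpositive frequencies.
  set A := posPart v with hA
  set B := v - A with hB
  set H : WienerAlg := NormedSpace.exp (-A) with hH
  have hAmem : A ∈ nonnegPart := fun n hn => by rw [hA, posPart_apply, if_neg hn.not_gt]
  have hBmem : B ∈ nonposPart := fun n hn => by
    change v n - posPart v n = 0
    rw [posPart_apply, if_pos hn, sub_self]
  have hHmem : H ∈ nonnegPart := exp_mem_of_isClosed isClosed_nonnegPart (neg_mem hAmem)
  have hexp : NormedSpace.exp v = NormedSpace.exp A * NormedSpace.exp B := by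
    apply eval_injective
    ext x
    rw [map_mul, ContinuousMap.mul_apply, eval_exp, eval_exp, eval_exp, ← Complex.exp_add, hB,
      map_sub, ContinuousMap.sub_apply, add_sub_cancel]
  have hF : monomial w 1 * ofReal hT * H = NormedSpace.exp B := by
    rw [← hv, hexp, hH, mul_right_comm, exp_mul_exp_neg, one_mul]
  have hreal (n : ℤ) : (starRingEnd ℂ) (H n) = H n := by
    rw [← conjCoeff_apply, hH, conjCoeff_exp]
    rw [conjCoeff_neg, conjCoeff_posPart_of_exp hT hv]
  have hre (n : ℤ) : (((H n).re : ℝ) : ℂ) = H n := Complex.conj_eq_iff_re.1 (hreal n)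
  have hsum : Summable fun n => |(H n).re| :=
    Summable.of_nonneg_of_le (fun _ => abs_nonneg _) (fun n => Complex.abs_re_le_norm _)
      H.summable_norm
  refine ⟨fun n => (H n).re, hsum, fun k => ?_,
    fun m n => ?_, fun c hc => ?_, fun g hg hg0 => ?_⟩
  · rw [hre]
    refine circleCoeff_eq_of_eval (fun x => ?_) k
    rw [hH, eval_exp, map_neg, ContinuousMap.neg_apply, Complex.exp_neg, hA, eval_posPart,
      wienerHopfPlus]
    simp only [circleCoeff_eq_of_eval fun x => (hvV x).symm]
  · have hmem : shift (m : ℕ) H ∈ nonnegPart := fun k hk => hHmem _ (by omega)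
    have h1 := mul_apply_of_nonneg (ofReal hT) hmem n
    -- The product is `z^{m-w} e^B`, whose frequencies are at most `m - w < 0`.
    have h2 : ofReal hT * shift (m : ℕ) H =
        shift ((m : ℕ) - w) (NormedSpace.exp B) := by
      rw [← monomial_mul, ← monomial_mul, ← hF, mul_assoc, ← mul_assoc (monomial _ 1),
        monomial_mul_monomial, sub_add_cancel, mul_left_comm]
    have h3 : (ofReal hT * shift (m : ℕ) H) n = 0 := by
      rw [h2, shift_apply]
      exact exp_mem_of_isClosed isClosed_nonposPart hBmem _ (by have := m.2; omega)
    rw [h3] at h1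
    apply Complex.ofReal_injective
    rw [Complex.ofReal_zero, h1, Complex.ofReal_tsum]
    refine tsum_congr fun k => ?_
    rw [Complex.ofReal_mul, hre, shift_apply, ofReal_apply]
  · have h1 : (∑ m : Fin w, monomial (m : ℕ) (c m : ℂ)) * H = 0 := by
      ext n
      rw [Finset.sum_mul]
      have h2 (m : Fin w) : monomial (m : ℕ) (c m : ℂ) * H = (c m : ℂ) • shift (m : ℕ) H := by
        rw [← monomial_mul, ← smul_mul_assoc]
        congr 1
        ext k
        change _ = (c m : ℂ) * monomial (m : ℕ) 1 k
        simp [monomial_apply]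
      simp only [h2]
      rw [lp.coeFn_sum, Finset.sum_apply]
      change ∑ m : Fin w, (c m : ℂ) * H (n - (m : ℕ)) = 0
      rcases lt_or_ge n 0 with hn | hn
      · exact Finset.sum_eq_zero fun m _ => by rw [hHmem _ (by omega), mul_zero]
      · lift n to ℕ using hn
        have h3 := congrArg (fun r : ℝ => (r : ℂ)) (hc n)
        simp only [Complex.ofReal_sum, Complex.ofReal_mul, hre, Complex.ofReal_zero] at h3
        exact h3
    have h2 : ∑ m : Fin w, monomial (m : ℕ) (c m : ℂ) = 0 := by
      rw [← mul_one (∑ m : Fin w, monomial (m : ℕ) (c m : ℂ)), ← exp_mul_exp_neg A,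
        mul_comm (NormedSpace.exp A), ← mul_assoc, h1, zero_mul]
    funext m
    have h3 : (∑ m : Fin w, monomial (m : ℕ) (c m : ℂ)) (m : ℕ) = 0 := by rw [h2]; rfl
    rw [lp.coeFn_sum, Finset.sum_apply, Finset.sum_eq_single m] at h3
    · rw [monomial_apply, if_pos rfl] at h3
      exact Complex.ofReal_eq_zero.1 h3
    · intro k _ hk
      rw [monomial_apply, if_neg]
      exact fun h => hk (Fin.ext (by exact_mod_cast h.symm))
    · simp
  · let g' : ℤ → ℝ := fun n => if 0 ≤ n then g n.toNat else 0
    have hg' : Summable fun n => |g' n| := by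
      rw [← Nat.cast_injective (R := ℤ) |>.summable_iff]
      · exact hg.congr fun n => by simp [g']
      · intro n hn
        have : ¬ 0 ≤ n := fun h => hn ⟨n.toNat, by omega⟩
        simp [g', this]
    have hGmem : ofReal hg' ∈ nonnegPart := fun n hn => by
      simp [ofReal_apply, g', hn.not_ge]
    have hG (n : ℕ) : ofReal hg' n = g n := by simp [ofReal_apply, g']
    have hFG (n : ℤ) (hn : 0 ≤ n) : (ofReal hT * ofReal hg') n = 0 := by
      lift n to ℕ using hn
      rw [mul_apply_of_nonneg _ hGmem]
      have h1 := congrArg (fun r : ℝ => (r : ℂ)) (hg0 n)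
      simp only [Complex.ofReal_tsum, Complex.ofReal_mul, Complex.ofReal_zero] at h1
      simpa only [hG, ofReal_apply] using h1
    set P := ofReal hg' * NormedSpace.exp A with hP
    have hPmem : P ∈ nonnegPart :=
      mul_mem hGmem (exp_mem_of_isClosed isClosed_nonnegPart hAmem)
    -- The second expression for `P` bounds its frequencies above by `w - 1`, since `F G` has only
    -- negative frequencies and `e^{-B}` only nonpositive ones.
    have hPB : P = shift w (ofReal hT * ofReal hg' * NormedSpace.exp (-B)) := by
      rw [← monomial_mul]
      calc P = P * (NormedSpace.exp B * NormedSpace.exp (-B)) := by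
            rw [exp_mul_exp_neg, mul_one]
        _ = ofReal hg' * NormedSpace.exp v * NormedSpace.exp (-B) := by rw [hexp, hP]; ring
        _ = _ := by rw [hv]; ring
    have hPw (n : ℤ) (hn : w ≤ n) : P n = 0 := by
      rw [hPB, shift_apply, mul_apply]
      refine (tsum_congr fun k => ?_).trans tsum_zero
      rcases lt_or_ge k 0 with hk | hk
      · rw [exp_mem_of_isClosed isClosed_nonposPart (neg_mem hBmem) _ (by omega), mul_zero]
      · rw [hFG k hk, zero_mul]
    have hGP : ofReal hg' = P * H := by rw [hP, hH, mul_assoc, exp_mul_exp_neg, mul_one]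
    refine ⟨fun m => (P (m : ℕ)).re, fun n => ?_⟩
    have h1 := congrArg Complex.re (eq_sum_shift hGP hPmem hPw n)
    rw [hG, Complex.ofReal_re, Complex.re_sum] at h1
    rw [h1]
    refine Finset.sum_congr rfl fun m _ => ?_
    conv_lhs => rw [← hre, mul_comm, Complex.re_ofReal_mul, mul_comm]

/-! ### Filling singularities: finite differences and decay rates. -/

theorem rpow_le_two_rpow_mul {x y : ℝ} (hx : 0 < x) (h1 : x / 2 ≤ y) (h2 : y ≤ x) (s : ℝ) :
    y ^ s ≤ 2 ^ |s| * x ^ s := by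
  have hy : 0 < y := by linarith
  rcases le_or_gt 0 s with hs | hs
  · calc y ^ s ≤ x ^ s := Real.rpow_le_rpow hy.le h2 hs
      _ ≤ 2 ^ |s| * x ^ s := le_mul_of_one_le_left (by positivity)
          (Real.one_le_rpow (by norm_num) (abs_nonneg _))
  · calc y ^ s ≤ (x / 2) ^ s := Real.rpow_le_rpow_of_nonpos (by linarith) h1 hs.le
      _ = 2 ^ |s| * x ^ s := by
          rw [Real.div_rpow hx.le (by norm_num), abs_of_neg hs, Real.rpow_neg (by norm_num)]
          field_simp

/-- The unit backward difference of a function. -/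
def backDiff (φ : ℝ → ℝ) (x : ℝ) : ℝ := φ (x - 1) - φ x

/-- Here `φ i` plays the `i`-th derivative. The mean value theorem trades one difference for one
derivative at a point of `(x - 1, x)`, and the induction runs on the differenced family. Beyond `x₀
+ 1 ≥ 2` that point exceeds `x / 2`, whence the factor `2 ^ |β|`. -/
theorem abs_iterate_backDiff_le (N : ℕ) (β : ℝ) : ∀ (φ : ℕ → ℝ → ℝ) (x₀ C : ℝ), 1 ≤ x₀ →
    (∀ i < N, ∀ x, x₀ < x → HasDerivAt (φ i) (φ (i + 1) x) x) →
    (∀ x, x₀ < x → |φ N x| ≤ C * x ^ β) →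
    ∃ C' x₁ : ℝ, ∀ x, x₁ < x → |backDiff^[N] (φ 0) x| ≤ C' * x ^ β := by
  induction N with
  | zero => exact fun φ x₀ C _ _ h => ⟨C, x₀, h⟩
  | succ N ih =>
    intro φ x₀ C hx₀ hd hb
    refine ih (fun i => backDiff (φ i)) (x₀ + 1) (C * 2 ^ |β|) (by linarith) (fun i hi x hx => ?_)
      fun x hx => ?_
    · exact ((hd i (by omega) (x - 1) (by linarith)).comp_sub_const x 1).sub
        (hd i (by omega) x (by linarith))
    · obtain ⟨ξ, hξ, h1⟩ := exists_hasDerivAt_eq_slope (φ N) (φ (N + 1)) (by linarith : x - 1 < x)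
        (fun y hy => (hd N (by omega) y (by linarith [hy.1])).continuousAt.continuousWithinAt)
        (fun y hy => hd N (by omega) y (by linarith [hy.1]))
      rw [sub_sub_cancel, div_one] at h1
      have h2 := hb ξ (by linarith [hξ.1])
      have hC : 0 ≤ C := by
        have hpos : 0 < ξ ^ β := Real.rpow_pos_of_pos (by linarith [hξ.1]) _
        exact nonneg_of_mul_nonneg_left ((abs_nonneg _).trans h2) hpos
      have h3 : backDiff (φ N) x = -φ (N + 1) ξ := by
        rw [h1, backDiff]
        ring
      rw [h3, abs_neg, mul_assoc]
      exact h2.trans (mul_le_mul_of_nonneg_left (rpow_le_two_rpow_mul (by linarith)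
        (by linarith [hξ.1]) hξ.2.le β) hC)

theorem exists_abs_iterate_backDiff_rpow_le (N : ℕ) (α : ℝ) :
    ∃ C x₁ : ℝ, ∀ x, x₁ < x → |backDiff^[N] (fun x => x ^ (-α)) x| ≤ C * x ^ (-(α + N)) := by
  let c : ℕ → ℝ := fun i => ∏ k ∈ Finset.range i, (-α - k)
  have hd : ∀ i < N, ∀ x : ℝ, 1 < x → HasDerivAt (fun x : ℝ => c i * x ^ (-α - i))
      (c (i + 1) * x ^ (-α - (i + 1 : ℕ))) x := by
    intro i _ x hx
    have h1 := (Real.hasDerivAt_rpow_const (x := x) (p := -α - i)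
      (Or.inl (by linarith))).const_mul (c i)
    refine h1.congr_deriv ?_
    simp only [c, Finset.prod_range_succ, Nat.cast_add, Nat.cast_one]
    rw [← sub_sub]
    ring
  have hb : ∀ x : ℝ, 1 < x → |c N * x ^ (-α - N)| ≤ |c N| * x ^ (-(α + N)) := by
    intro x hx
    rw [abs_mul, Real.abs_rpow_of_nonneg (by linarith), abs_of_pos (by linarith : 0 < x), neg_add']
  have h := abs_iterate_backDiff_le N (-(α + N)) (fun i x => c i * x ^ (-α - i)) 1 |c N| le_rfl
    hd hb
  simpa [c] using h

/-- Translation of sequences by one site. -/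
def seqShift : Module.End ℂ (ℤ → ℂ) where
  toFun u n := u (n - 1)
  map_add' _ _ := rfl
  map_smul' _ _ := rfl

theorem seqShift_pow_apply (m : ℕ) (u : ℤ → ℂ) (n : ℤ) : (seqShift ^ m) u n = u (n - m) := by
  induction m generalizing n with
  | zero => simp
  | succ m ih =>
    rw [pow_succ', Module.End.mul_apply]
    change (seqShift ^ m) u (n - 1) = _
    rw [ih]
    congr 1
    push_cast
    ring

/-- Sequences that are `O(n^{-ε})` as `n → ∞`. -/
def decaying (ε : ℝ) : Submodule ℂ (ℤ → ℂ) where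
  carrier := {u | (fun n : ℕ => u n) =O[atTop] fun n : ℕ => (n : ℝ) ^ (-ε)}
  add_mem' h1 h2 := IsBigO.add h1 h2
  zero_mem' := isBigO_zero _ _
  smul_mem' c _ h := IsBigO.const_smul_left h c

theorem mem_decaying {ε : ℝ} {u : ℤ → ℂ} :
    u ∈ decaying ε ↔ (fun n : ℕ => u n) =O[atTop] fun n : ℕ => (n : ℝ) ^ (-ε) := Iff.rfl

theorem isBigO_rpow_neg {ε ε' : ℝ} (h : ε ≤ ε') :
    (fun n : ℕ => (n : ℝ) ^ (-ε')) =O[atTop] fun n : ℕ => (n : ℝ) ^ (-ε) := by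
  refine IsBigO.of_bound 1 ?_
  filter_upwards [eventually_ge_atTop 1] with n hn
  have hn' : (1 : ℝ) ≤ n := by exact_mod_cast hn
  rw [one_mul, Real.norm_of_nonneg (by positivity), Real.norm_of_nonneg (by positivity)]
  exact Real.rpow_le_rpow_of_exponent_le hn' (by linarith)

theorem decaying_anti {ε ε' : ℝ} (h : ε ≤ ε') : decaying ε' ≤ decaying ε :=
  fun _ hu => IsBigO.trans hu (isBigO_rpow_neg h)

theorem seqShift_mem_decaying {ε : ℝ} {u : ℤ → ℂ} (hu : u ∈ decaying ε) :
    seqShift u ∈ decaying ε := by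
  have h1 := IsBigO.comp_tendsto (mem_decaying.1 hu) (tendsto_sub_atTop_nat 1)
  have h2 : (fun n : ℕ => (((n - 1 : ℕ) : ℝ)) ^ (-ε)) =O[atTop] fun n : ℕ => (n : ℝ) ^ (-ε) := by
    refine IsBigO.of_bound (2 ^ |(-ε)|) ?_
    filter_upwards [eventually_ge_atTop 2] with n hn
    have hn' : (2 : ℝ) ≤ n := by exact_mod_cast hn
    rw [Real.norm_of_nonneg (by positivity), Real.norm_of_nonneg (by positivity)]
    have h3 : ((n - 1 : ℕ) : ℝ) = n - 1 := by rw [Nat.cast_sub (by omega), Nat.cast_one]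
    rw [h3]
    exact rpow_le_two_rpow_mul (by linarith) (by linarith) (by linarith) _
  refine IsBigO.trans (IsBigO.congr' h1 ?_ EventuallyEq.rfl) h2
  filter_upwards [eventually_ge_atTop 1] with n hn
  change u ((n - 1 : ℕ) : ℤ) = u ((n : ℤ) - 1)
  rw [Nat.cast_sub hn, Nat.cast_one]

open Polynomial in
theorem aeval_seqShift_mem_decaying (q : ℂ[X]) {ε : ℝ} {u : ℤ → ℂ} (hu : u ∈ decaying ε) :
    aeval seqShift q u ∈ decaying ε := by
  rw [aeval_eq_sum_range, LinearMap.sum_apply]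
  refine Submodule.sum_mem _ fun m hm => ?_
  rw [LinearMap.smul_apply]
  refine Submodule.smul_mem _ _ ?_
  clear hm
  induction m with
  | zero => simpa using hu
  | succ m ih =>
    rw [pow_succ', Module.End.mul_apply]
    exact seqShift_mem_decaying ih

/-- The sequence `e^{inθ} φ(n)`. -/
noncomputable def modulated (θ : ℝ) (φ : ℝ → ℝ) (n : ℤ) : ℂ := exp (n * θ * I) * (φ n : ℂ)

open Polynomial in
-- Shifting `e^{inθ}` by one site produces exactly the phase `e^{-iθ}` that is subtracted, so the
-- oscillation factors out and only a difference of `φ` remains.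
theorem aeval_X_sub_C_pow_modulated (θ : ℝ) (φ : ℝ → ℝ) (N : ℕ) :
    aeval seqShift ((X - C (exp (-(θ * I)))) ^ N) (modulated θ φ) =
      exp (-(θ * I)) ^ N • modulated θ (backDiff^[N] φ) := by
  induction N generalizing φ with
  | zero => simp
  | succ N ih =>
    have h1 : aeval seqShift (X - C (exp (-(θ * I)))) (modulated θ φ) =
        exp (-(θ * I)) • modulated θ (backDiff φ) := by
      funext n
      simp only [map_sub, aeval_X, aeval_C, LinearMap.sub_apply, Module.algebraMap_end_apply,
        Pi.sub_apply, Pi.smul_apply, smul_eq_mul]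
      change modulated θ φ (n - 1) - _ = _
      have h2 : exp ((n - 1 : ℤ) * θ * I) = exp (-(θ * I)) * exp (n * θ * I) := by
        rw [← Complex.exp_add]
        congr 1
        push_cast
        ring
      simp only [modulated, backDiff, h2]
      push_cast
      ring
    rw [pow_succ, map_mul, Module.End.mul_apply, h1, map_smul, ih, smul_smul, ← pow_succ',
      Function.iterate_succ_apply]

open Polynomial in
theorem aeval_X_sub_C_pow_modulated_mem (θ α : ℝ) (N : ℕ) :
    aeval seqShift ((X - C (exp (-(θ * I)))) ^ N) (modulated θ fun x => x ^ (-α)) ∈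
      decaying (α + N) := by
  rw [aeval_X_sub_C_pow_modulated]
  refine Submodule.smul_mem _ _ ?_
  obtain ⟨C, x₁, h⟩ := exists_abs_iterate_backDiff_rpow_le N α
  refine IsBigO.of_bound C ?_
  filter_upwards [tendsto_natCast_atTop_atTop.eventually_gt_atTop x₁] with n hn
  have h1 : ‖exp (((n : ℕ) : ℤ) * θ * I)‖ = 1 := by
    have := Complex.norm_exp_ofReal_mul_I (n * θ)
    push_cast at this ⊢
    exact this
  rw [modulated, norm_mul, h1, one_mul, Complex.norm_real, Real.norm_eq_abs,
    Real.norm_of_nonneg (by positivity)]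
  exact_mod_cast h n hn

open Polynomial in
/-- Filling the singularities: if `q` vanishes at each `e^{-iθ_s}` to order `N_s`, then multiplying
by `q` improves the decay `n^{-Ω_s}` at each singularity to `n^{-Ω_s-N_s}`. -/
theorem aeval_prod_mem_decaying {h : ℂ → ℂ} {r : ℕ} {θ Ω : Fin r → ℝ}
    (hs : HasSingularities h θ Ω) {N : Fin r → ℕ} {ε : ℝ} (hN : ∀ s, ε ≤ Ω s + N s) :
    aeval seqShift (∏ s, (X - C (exp (-(θ s * I)))) ^ N s : ℂ[X]) (circleCoeff h) ∈
      decaying ε := by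
  obtain ⟨-, a, p, hp, hexp⟩ := hs
  -- The expansion is cut where its remainder already decays like `n^{-ε}`; multiplication by a
  -- polynomial preserves that.
  obtain ⟨K, hK⟩ : ∃ K, ∀ s, ε - Ω s ≤ p s K :=
    (eventually_all.2 fun s => (hp s).2.2.2.eventually_ge_atTop (ε - Ω s)).exists
  set main : ℤ → ℂ := ∑ s, ∑ j ∈ Finset.range K,
    a s j • modulated (θ s) (fun x => x ^ (-(Ω s + p s j))) with hmain
  have hrem : circleCoeff h - main ∈ decaying ε := by
    refine IsBigO.trans ((hexp K).congr_left fun n => ?_)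
      (IsBigO.fun_sum (A := fun s (n : ℕ) => (n : ℝ) ^ (-(Ω s + p s K))) fun s _ =>
        isBigO_rpow_neg (by linarith [hK s]))
    rw [Pi.sub_apply, hmain, Finset.sum_apply]
    congr 1
    refine Finset.sum_congr rfl fun s _ => ?_
    rw [Finset.sum_apply]
    refine Finset.sum_congr rfl fun j _ => ?_
    simp only [Pi.smul_apply, modulated, smul_eq_mul, Int.cast_natCast]
    ring
  have hsplit : circleCoeff h = (circleCoeff h - main) + main := by abel
  rw [hsplit, map_add]
  refine Submodule.add_mem _ (aeval_seqShift_mem_decaying _ hrem) ?_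
  rw [hmain, map_sum]
  refine Submodule.sum_mem _ fun s _ => ?_
  rw [map_sum]
  refine Submodule.sum_mem _ fun j _ => ?_
  -- Only the factor at `θ s` improves this term, and the other factors do no harm. Every exponent
  -- here is at least `Ω s`, so integrality of the `p s j` plays no role.
  rw [map_smul, ← Finset.mul_prod_erase _ _ (Finset.mem_univ s), mul_comm, map_mul,
    Module.End.mul_apply]
  refine Submodule.smul_mem _ _ (aeval_seqShift_mem_decaying _ (decaying_anti ?_
    (aeval_X_sub_C_pow_modulated_mem (θ s) (Ω s + p s j) (N s))))
  have h0 : 0 ≤ p s j := (hp s).2.1 ▸ (hp s).2.2.1.monotone (Nat.zero_le j)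
  linarith [hN s]

/-- The natural ceiling counts the `n` with `Ω s + n < ε p`. Any such level must be listed, and by
monotonicity at an index before `p`. -/
theorem IsLowestLevels.sum_ceil_le {r k : ℕ} {Ω : Fin r → ℝ} {ε : Fin k → ℝ}
    (h : IsLowestLevels Ω ε) (p : Fin k) : ∑ s, ⌈ε p - Ω s⌉₊ ≤ p := by
  obtain ⟨hmono, σ, -, hσ, hlow⟩ := h
  have hsub : (Finset.univ.sigma fun s : Fin r => Finset.range ⌈ε p - Ω s⌉₊) ⊆
      (Finset.Iio p).image fun i => (⟨(σ i).1, (σ i).2⟩ : (_ : Fin r) × ℕ) := by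
    rintro ⟨s, n⟩ hsn
    have h1 : (n : ℝ) < ε p - Ω s := Nat.lt_ceil.1 (by simpa using hsn)
    obtain ⟨i, hi⟩ : (s, n) ∈ range σ := by
      by_contra hq
      have := hlow _ hq p
      dsimp only at this
      linarith
    refine Finset.mem_image.2 ⟨i, Finset.mem_Iio.2 (lt_of_not_ge fun hpi => ?_), by rw [hi]⟩
    have h2 := hmono hpi
    rw [hσ i, hi] at h2
    dsimp only at h2
    linarith
  calc ∑ s, ⌈ε p - Ω s⌉₊
      = (Finset.univ.sigma fun s : Fin r => Finset.range ⌈ε p - Ω s⌉₊).card := by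
        simp [Finset.card_sigma]
    _ ≤ (Finset.Iio p).card := (Finset.card_le_card hsub).trans Finset.card_image_le
    _ = p := Fin.card_Iio p

open Polynomial in
theorem exists_monic_combination_decaying {f : ℂ → ℂ} {r k : ℕ} {θ Ω : Fin r → ℝ}
    {ε : Fin k → ℝ} (hs : HasSingularities f θ Ω) (hε : IsLowestLevels Ω ε) {h : ℤ → ℝ}
    (hh : ∀ n, circleCoeff f n = h n) (p : Fin k) :
    ∃ c : Fin k → ℝ, c p = 1 ∧ (∀ m, p < m → c m = 0) ∧
      (fun n : ℕ => ∑ m : Fin k, c m * h ((n : ℤ) - (m : ℕ))) =O[atTop]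
        fun n : ℕ => (n : ℝ) ^ (-ε p) := by
  set N : Fin r → ℕ := fun s => ⌈ε p - Ω s⌉₊ with hN
  set q : ℂ[X] := ∏ s, (X - C (exp (-(θ s * I)))) ^ N s with hq
  have hmonic (s : Fin r) : ((X - C (exp (-(θ s * I)))) ^ N s).Monic := (monic_X_sub_C _).pow _
  have hqm : q.Monic := monic_prod_of_monic _ _ fun s _ => hmonic s
  have hdeg : q.natDegree ≤ p := by
    rw [hq, natDegree_prod_of_monic _ _ fun s _ => hmonic s]
    simp only [natDegree_pow, natDegree_X_sub_C, mul_one]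
    exact hε.sum_ceil_le p
  -- Padding with powers of `X` only translates the sequence, which keeps the decay, and makes the
  -- degree exactly `p` for the triangular change of basis.
  set Q : ℂ[X] := X ^ (p - q.natDegree) * q with hQ
  have hQm : Q.Monic := (monic_X_pow _).mul hqm
  have hQdeg : Q.natDegree = p := by
    rw [hQ, (monic_X_pow _).natDegree_mul hqm, natDegree_X_pow]
    omega
  have hdec : aeval seqShift Q (circleCoeff f) ∈ decaying (ε p) := by
    rw [hQ, map_mul, Module.End.mul_apply]
    refine aeval_seqShift_mem_decaying _ (aeval_prod_mem_decaying hs fun s => ?_)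
    linarith [Nat.le_ceil (ε p - Ω s)]
  -- As `h` is real, real parts of the coefficients give the real part of the complex combination,
  -- which decays at least as fast; the leading `1` survives.
  refine ⟨fun m => (Q.coeff m).re, ?_, fun m hm => ?_, ?_⟩
  · have := hQm.coeff_natDegree
    rw [hQdeg] at this
    exact (congrArg re this).trans one_re
  · exact congrArg re (coeff_eq_zero_of_natDegree_lt (by rw [hQdeg]; exact hm))
  · refine IsBigO.trans (IsBigO.of_bound 1 (Eventually.of_forall fun n => ?_)) hdec
    have h1 : ∑ m : Fin k, (Q.coeff m).re * h ((n : ℤ) - (m : ℕ)) =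
        (aeval seqShift Q (circleCoeff f) n).re := by
      rw [aeval_eq_sum_range' (n := k) (by rw [hQdeg]; exact p.2), LinearMap.sum_apply,
        Finset.sum_apply, Complex.re_sum, Finset.sum_range]
      refine Finset.sum_congr rfl fun m _ => ?_
      rw [LinearMap.smul_apply, Pi.smul_apply, seqShift_pow_apply, hh, smul_eq_mul,
        Complex.re_mul_ofReal]
    rw [one_mul, h1, Real.norm_eq_abs]
    exact Complex.abs_re_le_norm _

/-! ### Orthogonalisation and construction of the edge modes. -/

/-- Real square-summable wavefunctions on the half-infinite chain. -/
abbrev Wavefunction : Type := lp (fun _ : ℕ => ℝ) 2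

/-- Absolutely summable wavefunctions in the kernel of the half-infinite Toeplitz operator. -/
noncomputable def toeplitzKer {T : ℤ → ℝ} (hT : Summable fun n => |T n|) :
    Submodule ℝ Wavefunction where
  carrier := {g | (Summable fun n => |g n|) ∧ ∀ n : ℕ, ∑' k : ℕ, T ((n : ℤ) - k) * g k = 0}
  add_mem' {a b} ha hb := by
    refine ⟨Summable.of_nonneg_of_le (fun _ => abs_nonneg _) (fun n => abs_add_le (a n) (b n))
      (ha.1.add hb.1), fun n => ?_⟩
    have h1 := HasToeplitzCommutator.summable_toeplitz hT
      (IsMajoranaFamily.summable_sq_lp a) n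
    have h2 := HasToeplitzCommutator.summable_toeplitz hT
      (IsMajoranaFamily.summable_sq_lp b) n
    have h3 := h1.tsum_add h2
    rw [ha.2 n, hb.2 n, add_zero] at h3
    rw [← h3]
    exact tsum_congr fun k => mul_add _ _ _
  zero_mem' := by
    constructor
    · simp
    · simp
  smul_mem' r a ha := by
    refine ⟨(ha.1.mul_left |r|).congr fun n => (abs_mul r (a n)).symm, fun n => ?_⟩
    have h1 : ∑' k : ℕ, r * (T ((n : ℤ) - k) * a k) = 0 := by rw [tsum_mul_left, ha.2 n, mul_zero]
    rw [← h1]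
    exact tsum_congr fun k => mul_left_comm _ _ _

/-- Wavefunctions that are `O(n^{-ε})`. -/
def decayingWavefunctions (ε : ℝ) : Submodule ℝ Wavefunction where
  carrier := {g | (g : ℕ → ℝ) =O[atTop] fun n : ℕ => (n : ℝ) ^ (-ε)}
  add_mem' h1 h2 := IsBigO.add h1 h2
  zero_mem' := isBigO_zero _ _
  smul_mem' c _ h := IsBigO.const_smul_left h c

theorem memℓp_two_of_summable_abs {g : ℕ → ℝ} (hg : Summable fun n => |g n|) : Memℓp g 2 := by
  have h1 : Memℓp g 1 := by
    rw [memℓp_gen_iff (by norm_num)]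
    simpa using hg
  exact h1.of_exponent_ge (by norm_num)

theorem span_range_eq_of_triangular {E : Type*} [AddCommGroup E] [Module ℝ E] {w : ℕ}
    (u : Fin w → E) (c : Fin w → Fin w → ℝ) (h1 : ∀ p, c p p = 1)
    (h0 : ∀ p m, p < m → c p m = 0) :
    Submodule.span ℝ (range fun p => ∑ m, c p m • u m) = Submodule.span ℝ (range u) := by
  apply le_antisymm <;> rw [Submodule.span_le]
  · rintro _ ⟨p, rfl⟩
    exact Submodule.sum_mem _ fun m _ =>
      Submodule.smul_mem _ _ (Submodule.subset_span (mem_range_self m))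
  · rintro _ ⟨p, rfl⟩
    induction p using WellFoundedLT.induction with
    | ind p ih =>
      have h2 : u p = (∑ m, c p m • u m) - ∑ m ∈ Finset.univ.erase p, c p m • u m := by
        rw [← Finset.add_sum_erase _ _ (Finset.mem_univ p), h1, one_smul, add_sub_cancel_right]
      rw [h2]
      refine Submodule.sub_mem _ (Submodule.subset_span (mem_range_self p))
        (Submodule.sum_mem _ fun m hm => ?_)
      rcases lt_or_gt_of_ne (Finset.ne_of_mem_erase hm) with hmp | hmp
      · exact Submodule.smul_mem _ _ (ih m hmp)
      · rw [h0 p m hmp, zero_smul]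
        exact Submodule.zero_mem _

/-- Gram–Schmidt starting from the last vector: an orthogonal family with the same span, each of
whose members is a combination of the vectors that do not precede it. -/
theorem exists_orthogonal_of_span {E : Type*} [NormedAddCommGroup E] [InnerProductSpace ℝ E]
    {w : ℕ} (v : Fin w → E) : ∃ G : Fin w → E, (∀ p q, p ≠ q → inner ℝ (G p) (G q) = 0) ∧
      Submodule.span ℝ (range G) = Submodule.span ℝ (range v) ∧
      ∀ p, G p ∈ Submodule.span ℝ (v '' Ici p) := by
  refine ⟨fun p => InnerProductSpace.gramSchmidt ℝ (v ∘ Fin.rev) p.rev, fun p q hpq => ?_, ?_,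
    fun p => ?_⟩
  · exact InnerProductSpace.gramSchmidt_orthogonal ℝ _ fun h => hpq (Fin.rev_injective h)
  · have h1 : range (fun p : Fin w => InnerProductSpace.gramSchmidt ℝ (v ∘ Fin.rev) p.rev) =
        range (InnerProductSpace.gramSchmidt ℝ (v ∘ Fin.rev)) :=
      Fin.rev_surjective.range_comp _
    rw [h1, InnerProductSpace.span_gramSchmidt, Fin.rev_surjective.range_comp]
  · have h1 := InnerProductSpace.gramSchmidt_mem_span ℝ (v ∘ Fin.rev) (le_refl p.rev)
    refine Submodule.span_mono ?_ h1
    rintro _ ⟨i, hi, rfl⟩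
    exact ⟨i.rev, Fin.le_rev_iff.1 hi, rfl⟩

/-- Common form of both signs of `ω`. Only the Fourier coefficients of `f` matter, so `f` may be any
function sharing those of `1 / b₊`. -/
theorem exists_edgeModes {t T : ℤ → ℝ} {M M' : ℕ → FockOp} {c₀ : ℂ} (hM : IsMajoranaFamily M)
    (hM' : IsMajoranaFamily M') (hcomm : HasToeplitzCommutator t T M M' c₀)
    (hT : Summable fun n => |T n|) {w : ℕ} {V : ℂ → ℂ}
    (hV : IsContinuousLog (symbol T) (-(w : ℤ)) V) {f : ℂ → ℂ}
    (hf : ∀ k, circleCoeff f k = circleCoeff (fun z => (wienerHopfPlus V z)⁻¹) k)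
    {r : ℕ} {θ Ω : Fin r → ℝ} {ε : Fin w → ℝ} (hε : IsLowestLevels Ω ε)
    (hs : HasSingularities f θ Ω) :
    ∃ (γL γhat : Fin w → FockOp) (ghat : Fin w → ℕ → ℝ),
      (∀ m : Fin w, HasSum (fun n : ℕ => circleCoeff f ((n : ℤ) - (m : ℕ)) • M n) (γL m)) ∧
      (∀ p, IsEdgeMode t M (ghat p) (γhat p)) ∧
      LinearIndependent ℝ γhat ∧
      Submodule.span ℝ (range γhat) = Submodule.span ℝ (range γL) ∧
      (∀ (g : ℕ → ℝ) (X : FockOp), Summable (fun n => |g n|) →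
        IsEdgeMode t M g X → X ∈ Submodule.span ℝ (range γhat)) ∧
      (∀ p q, p ≠ q → γhat p * γhat q + γhat q * γhat p = 0) ∧
      (∀ p, ghat p =O[atTop] fun n : ℕ => (n : ℝ) ^ (-ε p)) := by
  obtain ⟨h, hsum, hcoeff, hker, hli, hcomplete⟩ := exists_wienerHopf hT hV
  have hfh (n : ℤ) : circleCoeff f n = h n := (hf n).trans (hcoeff n)
  have hsum' (m : Fin w) : Summable fun n : ℕ => |h ((n : ℤ) - (m : ℕ))| :=
    hsum.comp_injective (i := fun n : ℕ => (n : ℤ) - (m : ℕ)) fun a b hab => by simpa using hab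
  let u : Fin w → Wavefunction := fun m =>
    ⟨fun n : ℕ => h ((n : ℤ) - (m : ℕ)), memℓp_two_of_summable_abs (hsum' m)⟩
  have hu_sum (c : Fin w → ℝ) (n : ℕ) :
      (∑ m, c m • u m : Wavefunction) n = ∑ m, c m * h ((n : ℤ) - (m : ℕ)) := by
    rw [lp.coeFn_sum, Finset.sum_apply]
    rfl
  have hu_li : LinearIndependent ℝ u := by
    rw [Fintype.linearIndependent_iff]
    intro c hc
    refine congrFun (hli c fun n => ?_)
    rw [← hu_sum, hc]
    rfl
  have hu_ker : Submodule.span ℝ (range u) ≤ toeplitzKer hT := by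
    rw [Submodule.span_le]
    rintro _ ⟨m, rfl⟩
    exact ⟨hsum' m, hker m⟩
  choose c hc1 hc0 hcO using exists_monic_combination_decaying hs hε hfh
  let v : Fin w → Wavefunction := fun p => ∑ m, c p m • u m
  have hv_span : Submodule.span ℝ (range v) = Submodule.span ℝ (range u) :=
    span_range_eq_of_triangular u c hc1 hc0
  have hv_dec (p : Fin w) : v p ∈ decayingWavefunctions (ε p) :=
    (hcO p).congr_left fun n => (hu_sum (c p) n).symm
  obtain ⟨G, hG_orth, hG_span, hG_mem⟩ := exists_orthogonal_of_span v
  rw [hv_span] at hG_span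
  -- A dimension count: `w` vectors spanning the same space as the `w` independent `u m`.
  have hG_li : LinearIndependent ℝ G := by
    rw [linearIndependent_iff_card_eq_finrank_span, Set.finrank, hG_span]
    exact linearIndependent_iff_card_eq_finrank_span.1 hu_li
  have hG_ker (p : Fin w) : G p ∈ toeplitzKer hT :=
    hu_ker (hG_span ▸ Submodule.subset_span (mem_range_self p))
  have hspan : Submodule.span ℝ (range fun p => hM.modeMap (G p)) =
      Submodule.span ℝ (range fun m => hM.modeMap (u m)) := by
    have h1 (a : Fin w → Wavefunction) : Submodule.span ℝ (range fun p => hM.modeMap (a p)) =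
        (Submodule.span ℝ (range a)).map hM.modeMap := by
      rw [Submodule.map_span, ← range_comp]
      rfl
    rw [h1, h1, hG_span]
  refine ⟨fun m => hM.modeMap (u m), fun p => hM.modeMap (G p), fun p => G p, fun m => ?_,
    fun p => ⟨IsMajoranaFamily.summable_sq_lp _, hM.hasSum_modeMap _, ?_⟩, ?_, hspan,
    fun g X hg hX => ?_, fun p q hpq => ?_, fun p => ?_⟩
  · simp only [hfh]
    exact hM.hasSum_modeMap (u m)
  · exact hcomm.commutesWithChain hM' hT (hG_ker p).1 (hM.hasSum_modeMap _) (hG_ker p).2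
  · exact hG_li.map' hM.modeMap (LinearMap.ker_eq_bot.2 hM.modeMap_injective)
  · rw [hspan]
    obtain ⟨a, ha⟩ := hcomplete g hg
      (hcomm.toeplitz_eq_zero hM' hT hX.normalisable hX.hasSum hX.commutes)
    have h1 : X = hM.modeMap (∑ m, a m • u m) := by
      refine hX.hasSum.unique ?_
      have h2 := hM.hasSum_modeMap (∑ m, a m • u m)
      simpa only [hu_sum, ← ha] using h2
    rw [h1, map_sum]
    refine Submodule.sum_mem _ fun m _ => ?_
    rw [map_smul]
    exact Submodule.smul_mem _ _ (Submodule.subset_span (mem_range_self m))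
  · rw [hM.modeMap_anticomm, hG_orth p q hpq, mul_zero, Complex.ofReal_zero, zero_smul]
  -- Gram–Schmidt ran from the last index, so `G p` mixes in only `v q` with `q ≥ p`, which decay at
  -- least as fast as `n^{-ε p}`.
  · have h1 : Submodule.span ℝ (v '' Ici p) ≤ decayingWavefunctions (ε p) := by
      rw [Submodule.span_le]
      rintro _ ⟨q, hq, rfl⟩
      exact IsBigO.trans (hv_dec q) (isBigO_rpow_neg (hε.1 hq))
    exact h1 (hG_mem p)

/-! ### The reflection `z ↦ 1/z` and the two signs of the winding number. -/

theorem inv_mem_sphere {z : ℂ} (hz : z ∈ Metric.sphere (0 : ℂ) 1) :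
    z⁻¹ ∈ Metric.sphere (0 : ℂ) 1 := by
  rw [mem_sphere_zero_iff_norm] at hz ⊢
  rw [norm_inv, hz, inv_one]

theorem symbol_neg (t : ℤ → ℝ) (z : ℂ) : symbol (fun j => t (-j)) z = symbol t z⁻¹ := by
  rw [symbol, symbol, ← (Equiv.neg ℤ).tsum_eq]
  exact tsum_congr fun n => by simp

theorem IsContinuousLog.comp_inv {t : ℤ → ℝ} {ω : ℤ} {V : ℂ → ℂ}
    (hV : IsContinuousLog (symbol t) ω V) :
    IsContinuousLog (symbol fun j => t (-j)) (-ω) fun z => V z⁻¹ := by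
  refine ⟨hV.1.comp (continuousOn_inv₀.mono fun z hz => ?_) fun z hz => inv_mem_sphere hz,
    fun z hz => ?_⟩
  · rintro rfl
    simp at hz
  · rw [hV.2 _ (inv_mem_sphere hz), symbol_neg, inv_zpow', neg_neg]

open WienerAlg in
-- The Fourier coefficients of `V(1/z)` are those of `V` reflected; the two series then agree term
-- by term, so `z` need not lie on the circle.
theorem wienerHopfMinus_eq_wienerHopfPlus_comp_inv {T : ℤ → ℝ} (hT : Summable fun n => |T n|)
    {w : ℤ} {V : ℂ → ℂ} (hV : IsContinuousLog (symbol T) (-w) V) (z : ℂ) :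
    wienerHopfMinus V (1 / z) = wienerHopfPlus (fun z => V z⁻¹) z := by
  obtain ⟨v, hv, -⟩ := exists_eval_eq_log_symbol hT hV
  have h1 (x : ℝ) : V (exp (x * I))⁻¹ = eval (reflect v) x := by
    have h2 := hv (-x)
    rw [eval_reflect, ← Complex.exp_neg]
    push_cast at h2
    rw [← neg_mul, ← h2]
    rfl
  unfold wienerHopfMinus wienerHopfPlus
  congr 1
  refine tsum_congr fun k => ?_
  rw [circleCoeff_eq_of_eval fun x => (hv x).symm, circleCoeff_eq_of_eval h1, reflect_apply,
    one_div, inv_zpow', neg_neg]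

theorem theorem2 (t : ℤ → ℝ) (ht : Summable fun n => |t n|)
    (hgap : ∀ z ∈ Metric.sphere (0 : ℂ) 1, symbol t z ≠ 0)
    (ω : ℤ) (hω : HasWindingNumber (symbol t) ω)
    (V : ℂ → ℂ) (hV : IsContinuousLog (symbol t) ω V)
    (r : ℕ) (θ Ω : Fin r → ℝ)
    (ε : Fin ω.natAbs → ℝ) (hε : IsLowestLevels Ω ε) :
    (0 < ω → HasSingularities (fun z => (wienerHopfMinus V (1 / z))⁻¹) θ Ω →
      ∃ (γL γhat : Fin ω.natAbs → FockOp) (ghat : Fin ω.natAbs → ℕ → ℝ),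
        (∀ m : Fin ω.natAbs, HasSum (fun n : ℕ =>
          circleCoeff (fun z => (wienerHopfMinus V (1 / z))⁻¹) ((n : ℤ) - (m : ℕ)) •
            majoranaRe n) (γL m)) ∧
        (∀ p, IsEdgeMode t majoranaRe (ghat p) (γhat p)) ∧
        LinearIndependent ℝ γhat ∧
        Submodule.span ℝ (range γhat) = Submodule.span ℝ (range γL) ∧
        (∀ (g : ℕ → ℝ) (X : FockOp), Summable (fun n => |g n|) →
          IsEdgeMode t majoranaRe g X → X ∈ Submodule.span ℝ (range γhat)) ∧
        (∀ p q, p ≠ q → γhat p * γhat q + γhat q * γhat p = 0) ∧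
        (∀ p, ghat p =O[atTop] fun n : ℕ => (n : ℝ) ^ (-ε p))) ∧
    (ω < 0 → HasSingularities (fun z => (wienerHopfPlus V z)⁻¹) θ Ω →
      ∃ (γL γhat : Fin ω.natAbs → FockOp) (ghat : Fin ω.natAbs → ℕ → ℝ),
        (∀ m : Fin ω.natAbs, HasSum (fun n : ℕ =>
          circleCoeff (fun z => (wienerHopfPlus V z)⁻¹) ((n : ℤ) - (m : ℕ)) •
            majoranaIm n) (γL m)) ∧
        (∀ p, IsEdgeMode t majoranaIm (ghat p) (γhat p)) ∧
        LinearIndependent ℝ γhat ∧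
        Submodule.span ℝ (range γhat) = Submodule.span ℝ (range γL) ∧
        (∀ (g : ℕ → ℝ) (X : FockOp), Summable (fun n => |g n|) →
          IsEdgeMode t majoranaIm g X → X ∈ Submodule.span ℝ (range γhat)) ∧
        (∀ p q, p ≠ q → γhat p * γhat q + γhat q * γhat p = 0) ∧
        (∀ p, ghat p =O[atTop] fun n : ℕ => (n : ℝ) ^ (-ε p))) := by
  constructor
  · intro hpos hs
    -- Real modes see the reflected coefficients `t (-j)`, whose symbol `f(1/z)` carries the
    -- exponent `-ω < 0` required by `exists_edgeModes`.
    have hV' := hV.comp_inv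
    rw [← Int.natAbs_of_nonneg hpos.le] at hV'
    have ht' : Summable fun n => |t (-n)| := (Equiv.neg ℤ).summable_iff.2 ht
    have hf : (fun z => (wienerHopfMinus V (1 / z))⁻¹) =
        fun z => (wienerHopfPlus (fun z => V z⁻¹) z)⁻¹ := by
      funext z
      rw [wienerHopfMinus_eq_wienerHopfPlus_comp_inv ht (w := -ω) (by rwa [neg_neg])]
    exact exists_edgeModes isMajoranaFamily_re isMajoranaFamily_im (hasToeplitzCommutator_re t) ht'
      hV' (fun k => by rw [hf]) hε hs
  · intro hneg hs
    have hw : -((ω.natAbs : ℕ) : ℤ) = ω := by omega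
    rw [← hw] at hV
    exact exists_edgeModes isMajoranaFamily_im isMajoranaFamily_re (hasToeplitzCommutator_im t) ht
      hV (fun k => rfl) hε hs
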